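/- Let $0\le r\le n$, let $M$ be an integer $r\times(n-r)$ matrix, and put $D=\begin{pmatrix} I_r & M\end{pmatrix}$ and $\widehat D=\begin{pmatrix}-M^T & I_{n-r}\end{pmatrix}$. A *basis* of $D$ is a set $B\subseteq\{1,\dots,n\}$ of $r$ column indices such that the determinant of $D$ restricted to the columns in $B$ is nonzero; the absolute value of this determinant is denoted $m(B)$, and $\mathcal B(D)$ is the set of bases. The fundamental parallelepiped of a square matrix with columns $x_1,\dots,x_k$ is $\{\sum_i a_ix_i : 0\le a_i\le 1\}$. For $B\in\mathcal B(D)$ let $P_1(B)\subset\mathbb R^r$ be the fundamental parallelepiped of $D$ restricted to the columns in $B$, let $P_2(B)\subset\mathbb R^{n-r}$ be that of $\widehat D$ restricted to the columns not in $B$, and let $P(B)=P_1(B)\times P_2(B)\subset\mathbb R^n$. A *shifting vector* is a vector $(w,\widehat w)\in\mathbb R^r\times\mathbb R^{n-r}$ that, for every $B\in\mathcal B(D)$, does not lie in the linear subspace parallel to any facet of $P(B)$. A vector $v\in\mathbb R^r$ is *$w$-associated* with $P_1(B)$ if $v+\epsilon w\in P_1(B)$ for all sufficiently small $\epsilon>0$,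 and $\widehat v\in\mathbb R^{n-r}$ is *$\widehat w$-associated* with $P_2(B)$ if $\widehat v+\epsilon\widehat w\in P_2(B)$ for all sufficiently small $\epsilon>0$. Define $$T'(D)=\bigcup_{B\in\mathcal B(D)}\ \bigcup_{\substack{z\in\mathbb Z^{n-r}\ \widehat w\text{-associated}\\ \text{with }P_2(B)}}\bigl(P_1(B)+Mz\bigr),\qquad T''(D)=\bigcup_{B\in\mathcal B(D)}\ \bigcup_{\substack{z\in\mathbb Z^{r}\ w\text{-associated}\\ \text{with }P_1(B)}}\bigl(P_2(B)-M^Tz\bigr).$$ **Theorem.** Let $(w,\widehat w)$ be a shifting vector. Then: 1. For each $B\in\mathcal B(D)$ there are exactly $m(B)$ vectors $z\in\mathbb Z^{n-r}$ that are $\widehat w$-associated with $P_2(B)$ and exactly $m(B)$ vectors $z\in\mathbb Z^r$ that are $w$-associated with $P_1(B)$; thus each basis $B$ contributes $m(B)$ translates of $P_1(B)$ to $T'(D)$ and $m(B)$ translates of $P_2(B)$ to $T''(D)$. 2. The parallelepipeds $P_1(B)+Mz$ that make up $T'(D)$ (for different pairs $(B,z)$) intersect only at their boundaries. 3. The parallelepipeds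 $P_2(B)-M^Tz$ that make up $T''(D)$ (for different pairs $(B,z)$) intersect only at their boundaries. 4. The translates $T'(D)+DD^Tz$, $z\in\mathbb Z^r$, cover $\mathbb R^r$, and for different $z$ they intersect only at their boundaries. 5. The translates $T''(D)+\widehat D\widehat D^T\widehat z$, $\widehat z\in\mathbb Z^{n-r}$, cover $\mathbb R^{n-r}$, and for different $\widehat z$ they intersect only at their boundaries. 6. For each $B\in\mathcal B(D)$ there are exactly $m(B)^2$ integer points $z\in\mathbb Z^r$ of $T'(D)$ such that, for all sufficiently small $\epsilon>0$, $z+\epsilon w$ lies in one of the translates of $P_1(B)$ that make up $T'(D)$. 7. For each $B\in\mathcal B(D)$ there are exactly $m(B)^2$ integer points $\widehat z\in\mathbb Z^{n-r}$ of $T''(D)$ such that, for all sufficiently small $\epsilon>0$, $\widehat z+\epsilon\widehat w$ lies in one of the translates of $P_2(B)$ that make up $T''(D)$. -/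

import Mathlib

open Set Filter Topology

noncomputable section

namespace StdRep

/-- The real vector with the same entries as an integer vector. -/
def toReal {ι : Type*} (z : ι → ℤ) : ι → ℝ := fun i => (z i : ℝ)

/-- The fundamental parallelepiped `{∑ⱼ aⱼ xⱼ | 0 ≤ aⱼ ≤ 1}` of a matrix with columns `xⱼ`. -/
def fundPar {ι κ : Type*} [Fintype κ] (A : Matrix ι κ ℝ) : Set (ι → ℝ) :=
  {x | ∃ a : κ → ℝ, (∀ j, 0 ≤ a j ∧ a j ≤ 1) ∧ x = A.mulVec a}

/-- The facet `{∑ⱼ aⱼ xⱼ | 0 ≤ aⱼ ≤ 1, aₖ = c}` of the fundamental parallelepiped of a square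
matrix with linearly independent columns `xⱼ`; here `c` is `0` or `1`. -/
def facet {ι κ : Type*} [Fintype κ] (A : Matrix ι κ ℝ) (k : κ) (c : ℝ) : Set (ι → ℝ) :=
  {x | ∃ a : κ → ℝ, (∀ j, 0 ≤ a j ∧ a j ≤ 1) ∧ a k = c ∧ x = A.mulVec a}

variable {r s : ℕ}

/-- The standard representative matrix `D = (I_r  M)`; its `n = r + s` columns are indexed by
`Fin r ⊕ Fin s`. -/
def stdMatrix (M : Matrix (Fin r) (Fin s) ℤ) : Matrix (Fin r) (Fin r ⊕ Fin s) ℤ :=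
  Matrix.fromCols 1 M

/-- The dual matrix `D̂ = (-Mᵀ  I_s)`. -/
def dualMatrix (M : Matrix (Fin r) (Fin s) ℤ) : Matrix (Fin s) (Fin r ⊕ Fin s) ℤ :=
  Matrix.fromCols (-M.transpose) 1

/-- The determinant of `D` restricted to the columns in `B`, in some order (so it is determined up
to sign); `0` if `B` does not consist of `r` columns. -/
def colDet (M : Matrix (Fin r) (Fin s) ℤ) (B : Finset (Fin r ⊕ Fin s)) : ℤ :=
  if h : B.card = r then
    ((stdMatrix M).submatrix id
      (fun i : Fin r => ((B.equivFinOfCardEq h).symm i : Fin r ⊕ Fin s))).det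
  else 0

/-- `B` is a basis of `D`: a set of `r` columns on which the determinant of `D` is nonzero. -/
def IsBasis (M : Matrix (Fin r) (Fin s) ℤ) (B : Finset (Fin r ⊕ Fin s)) : Prop :=
  B.card = r ∧ colDet M B ≠ 0

/-- The multiplicity `m(B)`: the magnitude of the determinant of `D` restricted to `B`. -/
def mult (M : Matrix (Fin r) (Fin s) ℤ) (B : Finset (Fin r ⊕ Fin s)) : ℕ :=
  (colDet M B).natAbs

/-- `P₁(B)`: the fundamental parallelepiped of `D` restricted to the columns in `B`. -/
def P₁ (M : Matrix (Fin r) (Fin s) ℤ) (B : Finset (Fin r ⊕ Fin s)) : Set (Fin r → ℝ) :=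
  fundPar (Matrix.of fun (i : Fin r) (j : {j // j ∈ B}) => (stdMatrix M i j.1 : ℝ))

/-- `P₂(B)`: the fundamental parallelepiped of `D̂` restricted to the columns not in `B`. -/
def P₂ (M : Matrix (Fin r) (Fin s) ℤ) (B : Finset (Fin r ⊕ Fin s)) : Set (Fin s → ℝ) :=
  fundPar (Matrix.of fun (i : Fin s) (j : {j // j ∉ B}) => (dualMatrix M i j.1 : ℝ))

/-- `P(B)`, the direct product of `P₁(B)` and `P₂(B)`, as a subset of `ℝⁿ`. -/
def P (M : Matrix (Fin r) (Fin s) ℤ) (B : Finset (Fin r ⊕ Fin s)) : Set (Fin r ⊕ Fin s → ℝ) :=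
  {x | (fun i => x (Sum.inl i)) ∈ P₁ M B ∧ (fun i => x (Sum.inr i)) ∈ P₂ M B}

/-- The `n × n` matrix that generates `P(B)`: a column of the full matrix `(D ; D̂)` keeps only
its first `r` entries if it belongs to `B`, and only its last `s` entries otherwise. -/
def prodMatrix (M : Matrix (Fin r) (Fin s) ℤ) (B : Finset (Fin r ⊕ Fin s)) :
    Matrix (Fin r ⊕ Fin s) (Fin r ⊕ Fin s) ℝ :=
  Matrix.of fun i j =>
    match i with
    | Sum.inl i => if j ∈ B then (stdMatrix M i j : ℝ) else 0
    | Sum.inr i => if j ∈ B then 0 else (dualMatrix M i j : ℝ)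

theorem prodMatrix_mulVec_inl (M : Matrix (Fin r) (Fin s) ℤ) (B : Finset (Fin r ⊕ Fin s))
    (a : Fin r ⊕ Fin s → ℝ) (i : Fin r) :
    (prodMatrix M B).mulVec a (Sum.inl i) = ∑ j : {j // j ∈ B}, (stdMatrix M i j.1 : ℝ) * a j.1 := by
  have h : (prodMatrix M B).mulVec a (Sum.inl i)
      = ∑ j, if j ∈ B then (stdMatrix M i j : ℝ) * a j else 0 := by
    simp [prodMatrix, Matrix.mulVec, dotProduct, ite_mul]
  rw [h, ← Finset.sum_filter]
  exact (Finset.sum_subtype _ (by simp) (fun j => (stdMatrix M i j : ℝ) * a j))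

theorem prodMatrix_mulVec_inr (M : Matrix (Fin r) (Fin s) ℤ) (B : Finset (Fin r ⊕ Fin s))
    (a : Fin r ⊕ Fin s → ℝ) (i : Fin s) :
    (prodMatrix M B).mulVec a (Sum.inr i)
      = ∑ j : {j // j ∉ B}, (dualMatrix M i j.1 : ℝ) * a j.1 := by
  have h : (prodMatrix M B).mulVec a (Sum.inr i)
      = ∑ j, if j ∉ B then (dualMatrix M i j : ℝ) * a j else 0 := by
    simp [prodMatrix, Matrix.mulVec, dotProduct, ite_mul]
  rw [h, ← Finset.sum_filter]
  exact (Finset.sum_subtype _ (by simp) (fun j => (dualMatrix M i j : ℝ) * a j))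

/-- `P(B)` is the fundamental parallelepiped of `prodMatrix M B`, so its facets are the sets
`facet (prodMatrix M B) k c` with `c = 0` or `c = 1`. -/
theorem P_eq_fundPar (M : Matrix (Fin r) (Fin s) ℤ) (B : Finset (Fin r ⊕ Fin s)) :
    P M B = fundPar (prodMatrix M B) := by
  ext x
  constructor
  · rintro ⟨⟨a, ha, hxa⟩, ⟨b, hb, hxb⟩⟩
    refine ⟨fun j => if h : j ∈ B then a ⟨j, h⟩ else b ⟨j, h⟩, ?_, ?_⟩
    · intro j
      by_cases h : j ∈ B
      · simpa [h] using ha ⟨j, h⟩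
      · simpa [h] using hb ⟨j, h⟩
    · funext i
      cases i with
      | inl i =>
        rw [prodMatrix_mulVec_inl]
        refine (congrFun hxa i).trans ?_
        simp only [Matrix.mulVec, dotProduct, Matrix.of_apply]
        refine Fintype.sum_congr _ _ fun j => ?_
        simp [j.2]
      | inr i =>
        rw [prodMatrix_mulVec_inr]
        refine (congrFun hxb i).trans ?_
        simp only [Matrix.mulVec, dotProduct, Matrix.of_apply]
        refine Fintype.sum_congr _ _ fun j => ?_
        simp [j.2]
  · rintro ⟨a, ha, rfl⟩
    refine ⟨⟨fun j => a j.1, fun j => ha j.1, ?_⟩, ⟨fun j => a j.1, fun j => ha j.1, ?_⟩⟩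
    · funext i
      exact prodMatrix_mulVec_inl M B a i
    · funext i
      exact prodMatrix_mulVec_inr M B a i

/-- A shifting vector: a vector of `ℝⁿ` that is not in the span of a facet of `P(B)` for any
basis `B`. The span of a facet is the linear subspace parallel to its affine span. -/
def IsShiftingVector (M : Matrix (Fin r) (Fin s) ℤ) (w : Fin r ⊕ Fin s → ℝ) : Prop :=
  ∀ B, IsBasis M B → ∀ k, ∀ c : ℝ, c = 0 ∨ c = 1 → w ∉ vectorSpan ℝ (facet (prodMatrix M B) k c)

/-- `v` is associated, along `w`, with the set `Q`: `v + ε w ∈ Q` for all sufficiently small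
`ε > 0`. -/
def Assoc {ι : Type*} (w : ι → ℝ) (Q : Set (ι → ℝ)) (v : ι → ℝ) : Prop :=
  ∀ᶠ ε : ℝ in 𝓝[>] 0, v + ε • w ∈ Q

/-- The translate `Q + v`. -/
def translate {ι : Type*} (Q : Set (ι → ℝ)) (v : ι → ℝ) : Set (ι → ℝ) :=
  (fun x => x + v) '' Q

/-- The integer vectors that are `ŵ`-associated with `P₂(B)`. -/
def shifts₁ (M : Matrix (Fin r) (Fin s) ℤ) (wh : Fin s → ℝ) (B : Finset (Fin r ⊕ Fin s)) :
    Set (Fin s → ℤ) :=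
  {z | Assoc wh (P₂ M B) (toReal z)}

/-- The integer vectors that are `w`-associated with `P₁(B)`. -/
def shifts₂ (M : Matrix (Fin r) (Fin s) ℤ) (w : Fin r → ℝ) (B : Finset (Fin r ⊕ Fin s)) :
    Set (Fin r → ℤ) :=
  {z | Assoc w (P₁ M B) (toReal z)}

/-- The parallelepiped `P₁(B) + M z`. -/
def piece₁ (M : Matrix (Fin r) (Fin s) ℤ) (B : Finset (Fin r ⊕ Fin s)) (z : Fin s → ℤ) :
    Set (Fin r → ℝ) :=
  translate (P₁ M B) (toReal (M.mulVec z))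

/-- The parallelepiped `P₂(B) - Mᵀ z`. -/
def piece₂ (M : Matrix (Fin r) (Fin s) ℤ) (B : Finset (Fin r ⊕ Fin s)) (z : Fin r → ℤ) :
    Set (Fin s → ℝ) :=
  translate (P₂ M B) (-toReal (M.transpose.mulVec z))

/-- The tile `T'(D)` in `ℝʳ`. -/
def tile₁ (M : Matrix (Fin r) (Fin s) ℤ) (wh : Fin s → ℝ) : Set (Fin r → ℝ) :=
  ⋃ B ∈ {B | IsBasis M B}, ⋃ z ∈ shifts₁ M wh B, piece₁ M B z

/-- The tile `T''(D)` in `ℝⁿ⁻ʳ`. -/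
def tile₂ (M : Matrix (Fin r) (Fin s) ℤ) (w : Fin r → ℝ) : Set (Fin s → ℝ) :=
  ⋃ B ∈ {B | IsBasis M B}, ⋃ z ∈ shifts₂ M w B, piece₂ M B z

/-- Two sets intersect only at their boundaries. -/
def MeetAtBoundary {ι : Type*} (Q R : Set (ι → ℝ)) : Prop :=
  Q ∩ R ⊆ frontier Q ∩ frontier R

/-- The translate `T'(D) + D Dᵀ z`. -/
def tileTranslate₁ (M : Matrix (Fin r) (Fin s) ℤ) (wh : Fin s → ℝ) (z : Fin r → ℤ) :
    Set (Fin r → ℝ) :=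
  translate (tile₁ M wh) (toReal ((stdMatrix M * (stdMatrix M).transpose).mulVec z))

/-- The translate `T''(D) + D̂ D̂ᵀ z`. -/
def tileTranslate₂ (M : Matrix (Fin r) (Fin s) ℤ) (w : Fin r → ℝ) (z : Fin s → ℤ) :
    Set (Fin s → ℝ) :=
  translate (tile₂ M w) (toReal ((dualMatrix M * (dualMatrix M).transpose).mulVec z))

end StdRep

end

noncomputable section

namespace StdRep

open Matrix

/-! Both tiles are slices of one tiling of `ℝⁿ`, whose cells are `P(B) + (D Z, -D̂ Z)` for bases `B`
and `Z ∈ ℤⁿ`. A point `(x, y)` lies in the cell of `(B, Z)` exactly when there are `p, q ∈ ℝⁿ` with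
`D p = x` and `D̂ q = -y` such that each pair `(p j, q j)` lies on the step with index `Z j` of a
monotone staircase in the plane, horizontal if `j ∈ B` and vertical otherwise.

Open cells are disjoint (`openCells_disjoint`): two such pairs differ by elements of `ker D` and
`ker D̂`, which are orthogonal, while monotonicity makes every term of the inner product
nonnegative; hence all terms vanish. Cells exist (`exists_mem_staircase`): parametrized by `u = p +
q`, the staircase has `p - q = wave u` with `wave` bounded and 1-Lipschitz, and the two linear
conditions become a fixed-point equation for a nonexpansive map. Cells of non-bases are null sets,
so local finiteness lets the basis cells cover everything (`exists_mem_basis_cell`).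

Slicing at `y = ε ŵ` for small `ε > 0` turns the second-factor condition into `ŵ`-association, and a
change of lattice coordinates splits the translation `D Z` into `D Dᵀ u + M v`. This gives the
tiling by `T'(D)`; exchanging the factors gives `T''(D)`. `IsProductTiling` records what the two
cases share.

The counts rest on two facts: associated integer points represent the quotient by the column lattice
(`ncard_assoc_fundPar`), and complementary minors of `D` and `D̂` agree up to sign
(`natAbs_det_frame₂`). -/

/-! ### Passing from integer to real vectors and matrices -/

theorem toReal_add {ι : Type*} (x y : ι → ℤ) : toReal (x + y) = toReal x + toReal y := by
  ext; simp [toReal]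

theorem toReal_sub {ι : Type*} (x y : ι → ℤ) : toReal (x - y) = toReal x - toReal y := by
  ext; simp [toReal]

theorem toReal_neg {ι : Type*} (x : ι → ℤ) : toReal (-x) = -toReal x := by
  ext; simp [toReal]

theorem toReal_injective {ι : Type*} : Function.Injective (toReal : (ι → ℤ) → ι → ℝ) := by
  intro x y h
  ext i
  simpa [toReal] using congrFun h i

/-- The real matrix with the same entries as an integer matrix. -/
abbrev realMat {ι κ : Type*} (A : Matrix ι κ ℤ) : Matrix ι κ ℝ := A.map (fun n => (n : ℝ))

theorem toReal_mulVec {ι κ : Type*} [Fintype κ] (A : Matrix ι κ ℤ) (x : κ → ℤ) :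
    toReal (A *ᵥ x) = realMat A *ᵥ toReal x := by
  ext i
  simp [toReal, Matrix.mulVec, dotProduct]

theorem det_realMat {κ : Type*} [Fintype κ] [DecidableEq κ] (E : Matrix κ κ ℤ) :
    (realMat E).det = (E.det : ℝ) := by
  have := (RingHom.map_det (Int.castRingHom ℝ) E).symm
  simpa [RingHom.mapMatrix_apply] using this

theorem isUnit_det_realMat {κ : Type*} [Fintype κ] [DecidableEq κ] {E : Matrix κ κ ℤ}
    (hE : E.det ≠ 0) : IsUnit (realMat E).det := by
  rw [det_realMat, isUnit_iff_ne_zero]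
  exact_mod_cast hE

/-! ### Fundamental parallelepipeds -/

theorem fundPar_eq_image {ι κ : Type*} [Fintype κ] (A : Matrix ι κ ℝ) :
    fundPar A = A.mulVecLin '' Icc 0 1 := by
  ext x
  constructor
  · rintro ⟨a, ha, rfl⟩
    exact ⟨a, ⟨fun j => (ha j).1, fun j => (ha j).2⟩, rfl⟩
  · rintro ⟨a, ha, rfl⟩
    exact ⟨a, fun j => ⟨ha.1 j, ha.2 j⟩, rfl⟩

theorem isCompact_fundPar {ι κ : Type*} [Fintype κ] (A : Matrix ι κ ℝ) :
    IsCompact (fundPar A) := by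
  rw [fundPar_eq_image]
  exact isCompact_Icc.image (by
    change Continuous fun v => A *ᵥ v
    fun_prop)

theorem convex_fundPar {ι κ : Type*} [Fintype κ] (A : Matrix ι κ ℝ) :
    Convex ℝ (fundPar A) := by
  rw [fundPar_eq_image]
  exact (convex_Icc _ _).linear_image _

theorem fundPar_submatrix_equiv {ι κ κ' : Type*} [Fintype κ] [Fintype κ'] (A : Matrix ι κ ℝ)
    (e : κ' ≃ κ) : fundPar (A.submatrix id e) = fundPar A := by
  have key : ∀ a : κ → ℝ, A.submatrix id e *ᵥ (a ∘ e) = A *ᵥ a := by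
    intro a
    rw [Matrix.submatrix_mulVec_equiv]
    simp [Function.comp_assoc]
  ext x
  constructor
  · rintro ⟨a, ha, rfl⟩
    refine ⟨a ∘ e.symm, fun j => ha _, ?_⟩
    rw [← key]
    simp [Function.comp_assoc]
  · rintro ⟨a, ha, rfl⟩
    exact ⟨a ∘ e, fun j => ha _, (key a).symm⟩

section Square

variable {κ : Type*} [Fintype κ] [DecidableEq κ]

/-- The open parallelepiped spanned by the columns of an invertible matrix. -/
def openPar (A : Matrix κ κ ℝ) : Set (κ → ℝ) := {x | ∀ j, (A⁻¹ *ᵥ x) j ∈ Ioo (0 : ℝ) 1}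

theorem mem_fundPar_iff {A : Matrix κ κ ℝ} (hA : IsUnit A.det) {x : κ → ℝ} :
    x ∈ fundPar A ↔ ∀ j, (A⁻¹ *ᵥ x) j ∈ Icc (0 : ℝ) 1 := by
  constructor
  · rintro ⟨a, ha, rfl⟩
    simpa [Matrix.mulVec_mulVec, Matrix.nonsing_inv_mul _ hA] using ha
  · intro h
    exact ⟨A⁻¹ *ᵥ x, h, by simp [Matrix.mulVec_mulVec, Matrix.mul_nonsing_inv _ hA]⟩

theorem isOpen_openPar (A : Matrix κ κ ℝ) : IsOpen (openPar A) := by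
  have : openPar A = (fun x => A⁻¹ *ᵥ x) ⁻¹' (Set.pi univ fun _ => Ioo (0 : ℝ) 1) := by
    ext x
    simp [openPar]
  rw [this]
  exact (isOpen_set_pi finite_univ fun _ _ => isOpen_Ioo).preimage (by fun_prop)

theorem fundPar_subset_closure_openPar {A : Matrix κ κ ℝ} (hA : IsUnit A.det) :
    fundPar A ⊆ closure (openPar A) := by
  rintro x ⟨a, ha, rfl⟩
  have hcl : a ∈ closure (Set.pi univ fun _ : κ => Ioo (0 : ℝ) 1) := by
    rw [closure_pi_set]
    intro j _
    rw [closure_Ioo zero_ne_one]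
    exact ha j
  have hcont : Continuous fun v => A *ᵥ v := by fun_prop
  refine closure_mono ?_ (image_closure_subset_closure_image hcont ⟨a, hcl, rfl⟩)
  rintro _ ⟨b, hb, rfl⟩ j
  simpa [Matrix.mulVec_mulVec, Matrix.nonsing_inv_mul _ hA] using hb j (mem_univ j)

end Square

/-! ### Association along a vector -/

/-- Closedness puts `v` in `Q`, and convexity adds the segment from `v` to one point `v + ε₀ w` of
`Q`. Pigeonhole arguments over finitely many sets yield only "frequently"; this upgrades their
conclusion. -/
theorem assoc_of_frequently {ι : Type*} {Q : Set (ι → ℝ)} (hQ : IsClosed Q) (hc : Convex ℝ Q)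
    {w v : ι → ℝ} (h : ∃ᶠ ε : ℝ in 𝓝[>] 0, v + ε • w ∈ Q) : Assoc w Q v := by
  have hcont : Tendsto (fun ε : ℝ => v + ε • w) (𝓝[>] 0) (𝓝 v) := by
    have : Continuous fun ε : ℝ => v + ε • w := by fun_prop
    simpa using (this.tendsto 0).mono_left nhdsWithin_le_nhds
  have hv : v ∈ Q := hQ.mem_of_frequently_of_tendsto h hcont
  obtain ⟨ε₀, h₀, hpos⟩ := (h.and_eventually self_mem_nhdsWithin).exists
  filter_upwards [Ioo_mem_nhdsGT hpos] with ε hε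
  have hpos' : (0 : ℝ) < ε₀ := hpos
  have := hc.add_smul_mem hv h₀ (t := ε / ε₀) ⟨by have := hε.1; positivity, by
    rw [div_le_one hpos']; exact hε.2.le⟩
  rwa [smul_smul, div_mul_cancel₀ _ hpos'.ne'] at this

theorem Assoc.mem {ι : Type*} {Q : Set (ι → ℝ)} (hQ : IsClosed Q) {w v : ι → ℝ}
    (h : Assoc w Q v) : v ∈ Q := by
  have hcont : Tendsto (fun ε : ℝ => v + ε • w) (𝓝[>] 0) (𝓝 v) := by
    have : Continuous fun ε : ℝ => v + ε • w := by fun_prop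
    simpa using (this.tendsto 0).mono_left nhdsWithin_le_nhds
  exact hQ.mem_of_tendsto hcont h

/-- The points of `[0, 1]` that remain there when moved slightly in the direction of `c`. -/
def halfOpen (c : ℝ) : Set ℝ := if 0 < c then Ico 0 1 else Ioc 0 1

theorem existsUnique_sub_int_mem_halfOpen (c t : ℝ) : ∃! n : ℤ, t - n ∈ halfOpen c := by
  unfold halfOpen
  split_ifs
  · simpa using existsUnique_sub_zsmul_mem_Ico (zero_lt_one (α := ℝ)) t 0
  · simpa using existsUnique_sub_zsmul_mem_Ioc (zero_lt_one (α := ℝ)) t 0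

theorem eventually_mem_Ioo_of_mem_halfOpen {c t : ℝ} (hc : c ≠ 0) (ht : t ∈ halfOpen c) :
    ∀ᶠ ε : ℝ in 𝓝[>] 0, t + ε * c ∈ Ioo (0 : ℝ) 1 := by
  have hcont : Tendsto (fun ε : ℝ => t + ε * c) (𝓝[>] 0) (𝓝 t) := by
    have : Continuous fun ε : ℝ => t + ε * c := by fun_prop
    simpa using (this.tendsto 0).mono_left nhdsWithin_le_nhds
  unfold halfOpen at ht
  split_ifs at ht with h
  · filter_upwards [hcont.eventually (gt_mem_nhds ht.2), self_mem_nhdsWithin] with ε h1 h2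
    exact ⟨add_pos_of_nonneg_of_pos ht.1 (mul_pos h2 h), h1⟩
  · have hneg : c < 0 := lt_of_le_of_ne (not_lt.mp h) hc
    filter_upwards [hcont.eventually (lt_mem_nhds ht.1), self_mem_nhdsWithin] with ε h1 h2
    have := mul_neg_of_pos_of_neg (show (0 : ℝ) < ε from h2) hneg
    exact ⟨h1, by linarith [ht.2]⟩

theorem mem_halfOpen_of_eventually {c t : ℝ} (hc : c ≠ 0)
    (h : ∀ᶠ ε : ℝ in 𝓝[>] 0, t + ε * c ∈ Icc (0 : ℝ) 1) : t ∈ halfOpen c := by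
  have hcont : Tendsto (fun ε : ℝ => t + ε * c) (𝓝[>] 0) (𝓝 t) := by
    have : Continuous fun ε : ℝ => t + ε * c := by fun_prop
    simpa using (this.tendsto 0).mono_left nhdsWithin_le_nhds
  have ht : t ∈ Icc (0 : ℝ) 1 := isClosed_Icc.mem_of_tendsto hcont h
  obtain ⟨ε, hε, hpos⟩ := (h.and self_mem_nhdsWithin).exists
  have hpos' : (0 : ℝ) < ε := hpos
  unfold halfOpen
  split_ifs with h0
  · exact ⟨ht.1, by nlinarith [hε.2, mul_pos hpos' h0]⟩
  · have hneg : c < 0 := lt_of_le_of_ne (not_lt.mp h0) hc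
    exact ⟨by nlinarith [hε.1, mul_neg_of_pos_of_neg hpos' hneg], ht.2⟩

/-! ### Counting the integer points associated with a parallelepiped -/

section Count

variable {κ : Type*} [Fintype κ] [DecidableEq κ] {A : Matrix κ κ ℝ} {w : κ → ℝ}

theorem inv_mulVec_add_smul (A : Matrix κ κ ℝ) (v w : κ → ℝ) (ε : ℝ) (j : κ) :
    (A⁻¹ *ᵥ (v + ε • w)) j = (A⁻¹ *ᵥ v) j + ε * (A⁻¹ *ᵥ w) j := by
  simp [Matrix.mulVec_add, Matrix.mulVec_smul]

/-- In the coordinates given by the columns the parallelepiped is the unit cube, and the sign of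
each coordinate of `w` decides which end of the interval is kept. -/
theorem assoc_fundPar_iff (hA : IsUnit A.det) (hw : ∀ j, (A⁻¹ *ᵥ w) j ≠ 0) {v : κ → ℝ} :
    Assoc w (fundPar A) v ↔ ∀ j, (A⁻¹ *ᵥ v) j ∈ halfOpen ((A⁻¹ *ᵥ w) j) := by
  constructor
  · intro h j
    refine mem_halfOpen_of_eventually (hw j) ?_
    filter_upwards [h] with ε hε
    simpa only [inv_mulVec_add_smul] using (mem_fundPar_iff hA).1 hε j
  · intro h
    have := eventually_all.2 fun j => eventually_mem_Ioo_of_mem_halfOpen (hw j) (h j)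
    filter_upwards [this] with ε hε
    rw [mem_fundPar_iff hA]
    intro j
    rw [inv_mulVec_add_smul]
    exact Ioo_subset_Icc_self (hε j)

theorem Assoc.eventually_mem_openPar (hA : IsUnit A.det) (hw : ∀ j, (A⁻¹ *ᵥ w) j ≠ 0)
    {v : κ → ℝ} (h : Assoc w (fundPar A) v) : ∀ᶠ ε : ℝ in 𝓝[>] 0, v + ε • w ∈ openPar A := by
  rw [assoc_fundPar_iff hA hw] at h
  have := eventually_all.2 fun j => eventually_mem_Ioo_of_mem_halfOpen (hw j) (h j)
  filter_upwards [this] with ε hε j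
  rw [inv_mulVec_add_smul]
  exact hε j

theorem card_quotient_range_mulVecLin {E : Matrix κ κ ℤ} (hE : E.det ≠ 0) :
    Nat.card ((κ → ℤ) ⧸ LinearMap.range E.mulVecLin) = E.det.natAbs := by
  have hinj : Function.Injective E.mulVecLin := Matrix.mulVec_injective_of_det_ne_zero hE
  rw [← Submodule.natAbs_det_equiv _ (LinearEquiv.ofInjective E.mulVecLin hinj)]
  congr 1
  rw [← LinearMap.det_toLin' E]
  rfl

/-- The number of integer points associated with an integral parallelepiped along a generic
vector is the magnitude of the determinant. -/
theorem ncard_assoc_fundPar {E : Matrix κ κ ℤ} (hE : E.det ≠ 0)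
    (hw : ∀ j, ((realMat E)⁻¹ *ᵥ w) j ≠ 0) :
    {z : κ → ℤ | Assoc w (fundPar (realMat E)) (toReal z)}.ncard = E.det.natAbs := by
  have hA := isUnit_det_realMat hE
  rw [← card_quotient_range_mulVecLin hE, ← Nat.card_coe_set_eq]
  have hcoord : ∀ z n : κ → ℤ, ∀ j, ((realMat E)⁻¹ *ᵥ toReal (z - E *ᵥ n)) j
      = ((realMat E)⁻¹ *ᵥ toReal z) j - n j := by
    intro z n j
    rw [toReal_sub, toReal_mulVec, Matrix.mulVec_sub, Matrix.mulVec_mulVec,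
      Matrix.nonsing_inv_mul _ hA, Matrix.one_mulVec]
    rfl
  -- Subtracting `E n` shifts the coordinates by the integers `n j`, so the half-open cube contains
  -- exactly one representative of each class modulo the column lattice.
  refine Nat.card_eq_of_bijective
    (fun z => (Submodule.Quotient.mk z.1 : (κ → ℤ) ⧸ LinearMap.range E.mulVecLin)) ⟨?_, ?_⟩
  · rintro ⟨z, hz⟩ ⟨z', hz'⟩ h
    obtain ⟨n, hn⟩ := (Submodule.Quotient.eq _).1 h
    have hz'_eq : z' = z - E *ᵥ n := by
      have : E *ᵥ n = z - z' := hn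
      rw [this]; abel
    have hn0 : n = 0 := by
      ext j
      have h1 := (assoc_fundPar_iff hA hw).1 hz j
      have h2 := (assoc_fundPar_iff hA hw).1 hz' j
      rw [hz'_eq, hcoord] at h2
      exact (existsUnique_sub_int_mem_halfOpen _ _).unique h2 (by simpa using h1)
    simp [hz'_eq, hn0]
  · intro q
    obtain ⟨z, rfl⟩ := Submodule.Quotient.mk_surjective _ q
    choose n hn using fun j => (existsUnique_sub_int_mem_halfOpen
      (((realMat E)⁻¹ *ᵥ w) j) (((realMat E)⁻¹ *ᵥ toReal z) j)).exists
    refine ⟨⟨z - E *ᵥ n, (assoc_fundPar_iff hA hw).2 fun j => ?_⟩, ?_⟩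
    · rw [hcoord]
      exact hn j
    · refine (Submodule.Quotient.eq _).2 ⟨-n, ?_⟩
      simp [Matrix.mulVec_neg]

end Count


section Staircase

variable {r s : ℕ}

/-! ### The orthogonal kernels of `D` and its dual -/

theorem realMat_stdMatrix_mulVec (M : Matrix (Fin r) (Fin s) ℤ) (k : Fin r ⊕ Fin s → ℝ) :
    realMat (stdMatrix M) *ᵥ k = k ∘ Sum.inl + realMat M *ᵥ (k ∘ Sum.inr) := by
  have : realMat (stdMatrix M) = Matrix.fromCols 1 (realMat M) := by
    ext i (j | j) <;> simp [stdMatrix, Matrix.one_apply, apply_ite]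
  rw [this, Matrix.fromCols_mulVec, Matrix.one_mulVec]

theorem realMat_dualMatrix_mulVec (M : Matrix (Fin r) (Fin s) ℤ) (k : Fin r ⊕ Fin s → ℝ) :
    realMat (dualMatrix M) *ᵥ k = -((realMat M)ᵀ *ᵥ (k ∘ Sum.inl)) + k ∘ Sum.inr := by
  have : realMat (dualMatrix M) = Matrix.fromCols (-(realMat M)ᵀ) 1 := by
    ext i (j | j) <;> simp [dualMatrix, Matrix.one_apply, apply_ite]
  rw [this, Matrix.fromCols_mulVec, Matrix.one_mulVec, Matrix.neg_mulVec]

/-- The kernels consist of the vectors `(-M m, m)` and `(a, Mᵀ a)` respectively. -/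
theorem dotProduct_eq_zero_of_mem_ker {M : Matrix (Fin r) (Fin s) ℤ} {k l : Fin r ⊕ Fin s → ℝ}
    (hk : realMat (stdMatrix M) *ᵥ k = 0) (hl : realMat (dualMatrix M) *ᵥ l = 0) :
    k ⬝ᵥ l = 0 := by
  rw [realMat_stdMatrix_mulVec] at hk
  rw [realMat_dualMatrix_mulVec] at hl
  have h1 : k ∘ Sum.inl = -(realMat M *ᵥ (k ∘ Sum.inr)) := eq_neg_of_add_eq_zero_left hk
  have h2 : l ∘ Sum.inr = (realMat M)ᵀ *ᵥ (l ∘ Sum.inl) := by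
    have := eq_neg_of_add_eq_zero_right hl
    simpa using this
  have h3 : k ⬝ᵥ l = (k ∘ Sum.inl) ⬝ᵥ (l ∘ Sum.inl) + (k ∘ Sum.inr) ⬝ᵥ (l ∘ Sum.inr) := by
    simp [dotProduct]
  rw [h3, h1, h2, Matrix.dotProduct_mulVec, Matrix.vecMul_transpose, neg_dotProduct]
  simp

/-! ### Steps of the monotone staircase -/

/-- The relative interior of a step of the monotone staircase of points `(p, q)` with horizontal
steps `q = z`, `z ≤ p ≤ z + 1` and vertical steps `p = z`, `z - 1 ≤ q ≤ z`. -/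
def OpenStep (b : Bool) (z : ℤ) (p q : ℝ) : Prop :=
  if b then q = z ∧ (z : ℝ) < p ∧ p < z + 1 else p = z ∧ (z : ℝ) - 1 < q ∧ q < z

theorem int_cast_trichotomy (z z' : ℤ) :
    (z : ℝ) = z' ∨ (z : ℝ) + 1 ≤ z' ∨ (z' : ℝ) + 1 ≤ z := by
  rcases lt_trichotomy z z' with h | h | h
  · exact Or.inr (Or.inl (by exact_mod_cast h))
  · exact Or.inl (by exact_mod_cast h)
  · exact Or.inr (Or.inr (by exact_mod_cast h))

/-- The staircase is a monotone relation: along it `p` and `q` never move in opposite directions. -/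
theorem OpenStep.mul_nonneg {b b' : Bool} {z z' : ℤ} {p q p' q' : ℝ} (h : OpenStep b z p q)
    (h' : OpenStep b' z' p' q') : 0 ≤ (p - p') * (q - q') := by
  have hz := int_cast_trichotomy z z'
  cases b <;> cases b' <;> simp only [OpenStep, if_true, Bool.false_eq_true, if_false] at h h' <;>
    obtain ⟨h1, h2, h3⟩ := h <;> obtain ⟨h1', h2', h3'⟩ := h' <;> rcases hz with hz | hz | hz
  all_goals first
    | exact _root_.mul_nonneg (by linarith) (by linarith)
    | exact mul_nonneg_of_nonpos_of_nonpos (by linarith) (by linarith)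
    | simp [show p = p' by linarith]
    | simp [show q = q' by linarith]

/-- The vertical line through an interior point of a horizontal step meets the staircase only there,
so even `p = p'` forces `q = q'`; symmetrically for a vertical step. -/
theorem OpenStep.eq_of_mul_eq_zero {b b' : Bool} {z z' : ℤ} {p q p' q' : ℝ}
    (h : OpenStep b z p q) (h' : OpenStep b' z' p' q') (h0 : (p - p') * (q - q') = 0) :
    if b then q = q' else p = p' := by
  have hz := int_cast_trichotomy z z'
  rcases mul_eq_zero.1 h0 with h0 | h0 <;>
  cases b <;> cases b' <;>
    simp only [OpenStep, if_true, Bool.false_eq_true, if_false] at h h' ⊢ <;>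
    obtain ⟨h1, h2, h3⟩ := h <;> obtain ⟨h1', h2', h3'⟩ := h' <;> rcases hz with hz | hz | hz <;>
    linarith

theorem OpenStep.unique {b b' : Bool} {z z' : ℤ} {p q : ℝ}
    (h : OpenStep b z p q) (h' : OpenStep b' z' p q) : b = b' ∧ z = z' := by
  have hz := int_cast_trichotomy z z'
  cases b <;> cases b' <;>
    simp only [OpenStep, if_true, Bool.false_eq_true, if_false] at h h' ⊢ <;>
    obtain ⟨h1, h2, h3⟩ := h <;> obtain ⟨h1', h2', h3'⟩ := h' <;> rcases hz with hz | hz | hz <;>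
    first
      | exact ⟨trivial, by exact_mod_cast hz⟩
      | (exfalso; linarith)

/-! ### Frames: orderings of the columns in which a basis comes first -/

/-- The square submatrix of `D` on the first `r` columns in the ordering `e`. -/
def frame₁ (M : Matrix (Fin r) (Fin s) ℤ) (e : Fin r ⊕ Fin s ≃ Fin r ⊕ Fin s) :
    Matrix (Fin r) (Fin r) ℤ := (stdMatrix M).submatrix id (e ∘ Sum.inl)

/-- The square submatrix of `D̂` on the last `s` columns in the ordering `e`. -/
def frame₂ (M : Matrix (Fin r) (Fin s) ℤ) (e : Fin r ⊕ Fin s ≃ Fin r ⊕ Fin s) :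
    Matrix (Fin s) (Fin s) ℤ := (dualMatrix M).submatrix id (e ∘ Sum.inr)

theorem mulVec_elim_left {ρ α β ι : Type*} [Fintype α] [Fintype β] [Fintype ι] (A : Matrix ρ ι ℝ)
    (e : α ⊕ β ≃ ι) (a : α → ℝ) :
    A *ᵥ (Sum.elim a 0 ∘ e.symm) = A.submatrix id (e ∘ Sum.inl) *ᵥ a := by
  ext i
  simp only [Matrix.mulVec, dotProduct, Matrix.submatrix_apply]
  rw [← e.sum_comp, Fintype.sum_sum_type]
  simp

theorem mulVec_elim_right {ρ α β ι : Type*} [Fintype α] [Fintype β] [Fintype ι] (A : Matrix ρ ι ℝ)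
    (e : α ⊕ β ≃ ι) (a : β → ℝ) :
    A *ᵥ (Sum.elim 0 a ∘ e.symm) = A.submatrix id (e ∘ Sum.inr) *ᵥ a := by
  ext i
  simp only [Matrix.mulVec, dotProduct, Matrix.submatrix_apply]
  rw [← e.sum_comp, Fintype.sum_sum_type]
  simp

theorem mulVec_inv_mulVec {κ : Type*} [Fintype κ] [DecidableEq κ] {A : Matrix κ κ ℝ}
    (hA : IsUnit A.det) (x : κ → ℝ) : A *ᵥ (A⁻¹ *ᵥ x) = x := by
  simp [Matrix.mulVec_mulVec, Matrix.mul_nonsing_inv _ hA]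

/-- A point in the interior of a cell comes from a point of the staircases. -/
theorem exists_openStep {M : Matrix (Fin r) (Fin s) ℤ} {e : Fin r ⊕ Fin s ≃ Fin r ⊕ Fin s}
    (h₁ : (frame₁ M e).det ≠ 0) (h₂ : (frame₂ M e).det ≠ 0) {Z : Fin r ⊕ Fin s → ℤ}
    {x : Fin r → ℝ} {y : Fin s → ℝ}
    (hx : x - toReal (stdMatrix M *ᵥ Z) ∈ openPar (realMat (frame₁ M e)))
    (hy : y + toReal (dualMatrix M *ᵥ Z) ∈ openPar (realMat (frame₂ M e))) :
    ∃ p q : Fin r ⊕ Fin s → ℝ, realMat (stdMatrix M) *ᵥ p = x ∧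
      realMat (dualMatrix M) *ᵥ q = -y ∧
      ∀ j, OpenStep (e.symm j).isLeft (Z j) (p j) (q j) := by
  set a := (realMat (frame₁ M e))⁻¹ *ᵥ (x - toReal (stdMatrix M *ᵥ Z)) with ha
  set b := (realMat (frame₂ M e))⁻¹ *ᵥ (y + toReal (dualMatrix M *ᵥ Z)) with hb
  refine ⟨toReal Z + Sum.elim a 0 ∘ e.symm, toReal Z - Sum.elim (0 : Fin r → ℝ) b ∘ e.symm, ?_, ?_, fun j => ?_⟩
  · have := mulVec_inv_mulVec (isUnit_det_realMat h₁) (x - toReal (stdMatrix M *ᵥ Z))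
    rw [Matrix.mulVec_add, mulVec_elim_left]
    change _ + realMat (frame₁ M e) *ᵥ a = _
    rw [ha, this, toReal_mulVec]
    abel
  · have := mulVec_inv_mulVec (isUnit_det_realMat h₂) (y + toReal (dualMatrix M *ᵥ Z))
    rw [Matrix.mulVec_sub, mulVec_elim_right]
    change _ - realMat (frame₂ M e) *ᵥ b = _
    rw [hb, this, toReal_mulVec]
    abel
  · obtain ⟨i, rfl⟩ := e.surjective j
    rcases i with i | i
    · have := hx i
      simp only [OpenStep, Equiv.symm_apply_apply, Sum.isLeft_inl, if_true, Pi.add_apply,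
        Pi.sub_apply, Function.comp_apply, Sum.elim_inl, toReal, Pi.zero_apply, sub_zero]
      exact ⟨trivial, by linarith [this.1], by linarith [this.2]⟩
    · have := hy i
      simp only [OpenStep, Equiv.symm_apply_apply, Sum.isLeft_inr, Bool.false_eq_true, if_false,
        Pi.add_apply, Pi.sub_apply, Function.comp_apply, Sum.elim_inr, Pi.zero_apply, toReal,
        add_zero]
      exact ⟨trivial, by linarith [this.2], by linarith [this.1]⟩

/-- Different cells of the tiling of `ℝⁿ` have disjoint interiors. -/
theorem openCells_disjoint {M : Matrix (Fin r) (Fin s) ℤ}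
    {e e' : Fin r ⊕ Fin s ≃ Fin r ⊕ Fin s}
    (h₁ : (frame₁ M e).det ≠ 0) (h₂ : (frame₂ M e).det ≠ 0)
    (h₁' : (frame₁ M e').det ≠ 0) (h₂' : (frame₂ M e').det ≠ 0)
    {Z Z' : Fin r ⊕ Fin s → ℤ} {x : Fin r → ℝ} {y : Fin s → ℝ}
    (hx : x - toReal (stdMatrix M *ᵥ Z) ∈ openPar (realMat (frame₁ M e)))
    (hy : y + toReal (dualMatrix M *ᵥ Z) ∈ openPar (realMat (frame₂ M e)))
    (hx' : x - toReal (stdMatrix M *ᵥ Z') ∈ openPar (realMat (frame₁ M e')))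
    (hy' : y + toReal (dualMatrix M *ᵥ Z') ∈ openPar (realMat (frame₂ M e'))) :
    (∀ j, (e.symm j).isLeft = (e'.symm j).isLeft) ∧ Z = Z' := by
  obtain ⟨p, q, hp, hq, hs⟩ := exists_openStep h₁ h₂ hx hy
  obtain ⟨p', q', hp', hq', hs'⟩ := exists_openStep h₁' h₂' hx' hy'
  have hk : realMat (stdMatrix M) *ᵥ (p - p') = 0 := by rw [Matrix.mulVec_sub, hp, hp', sub_self]
  have hl : realMat (dualMatrix M) *ᵥ (q - q') = 0 := by rw [Matrix.mulVec_sub, hq, hq', sub_self]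
  have hsum := dotProduct_eq_zero_of_mem_ker hk hl
  have hzero := (Finset.sum_eq_zero_iff_of_nonneg
    fun j _ => (hs j).mul_nonneg (hs' j)).1 hsum
  have heq := fun j => (hs j).eq_of_mul_eq_zero (hs' j) (hzero j (Finset.mem_univ j))
  -- The difference is supported on the first `r` columns of `e`, where `D` is nonsingular; likewise
  -- `q - q'` is supported on the others, where `D̂` is.
  have hpp : p - p' = 0 := by
    have h : p - p' = Sum.elim ((p - p') ∘ e ∘ Sum.inl) 0 ∘ e.symm := by
      ext j
      obtain ⟨i | i, rfl⟩ := e.surjective j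
      · simp
      · have := heq (e (Sum.inr i))
        simp only [Equiv.symm_apply_apply, Sum.isLeft_inr, Bool.false_eq_true, if_false] at this
        simp [this]
    rw [h, mulVec_elim_left] at hk
    have h0 := Matrix.eq_zero_of_mulVec_eq_zero
      (isUnit_iff_ne_zero.1 (isUnit_det_realMat h₁)) hk
    rw [h, h0]
    ext j
    obtain ⟨i | i, rfl⟩ := e.surjective j <;> simp
  have hqq : q - q' = 0 := by
    have h : q - q' = Sum.elim (0 : Fin r → ℝ) ((q - q') ∘ e ∘ Sum.inr) ∘ e.symm := by
      ext j
      obtain ⟨i | i, rfl⟩ := e.surjective j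
      · have := heq (e (Sum.inl i))
        simp only [Equiv.symm_apply_apply, Sum.isLeft_inl, if_true] at this
        simp [this]
      · simp
    rw [h, mulVec_elim_right] at hl
    have h0 := Matrix.eq_zero_of_mulVec_eq_zero
      (isUnit_iff_ne_zero.1 (isUnit_det_realMat h₂)) hl
    rw [h, h0]
    ext j
    obtain ⟨i | i, rfl⟩ := e.surjective j <;> simp
  obtain rfl := sub_eq_zero.1 hpp
  obtain rfl := sub_eq_zero.1 hqq
  exact ⟨fun j => ((hs j).unique (hs' j)).1, funext fun j => ((hs j).unique (hs' j)).2⟩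

end Staircase

section Existence

/-! ### Existence of a cell through every point -/

/-- Each `(1 - t) f` is a contraction, and its fixed point is moved by `f` by at most `t C`. These
points stay in a compact ball, so the minimal displacement there is zero. -/
theorem exists_fixedPoint_of_nonexpansive {E : Type*} [NormedAddCommGroup E] [NormedSpace ℝ E]
    [ProperSpace E] {f : E → E} (hf : ∀ x y, ‖f x - f y‖ ≤ ‖x - y‖) {C : ℝ}
    (hC : ∀ x, ‖f x‖ ≤ C) : ∃ x, f x = x := by
  have hC0 : 0 ≤ C := (norm_nonneg _).trans (hC 0)
  have hcont : Continuous f := by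
    refine (LipschitzWith.of_dist_le_mul (K := 1) fun x y => ?_).continuous
    simpa [dist_eq_norm] using hf x y
  obtain ⟨x, -, hx⟩ := (isCompact_closedBall (0 : E) C).exists_isMinOn
    ⟨0, by simpa using hC0⟩ (f := fun x => ‖f x - x‖) (by fun_prop)
  refine ⟨x, sub_eq_zero.1 (norm_eq_zero.1 (le_antisymm ?_ (norm_nonneg _)))⟩
  refine le_of_forall_pos_le_add fun δ hδ => ?_
  obtain ⟨t, ht0, ht1, htδ⟩ : ∃ t : ℝ, 0 < t ∧ t < 1 ∧ t * C ≤ δ := by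
    refine ⟨min (1 / 2) (δ / (C + 1)), by positivity, by
      linarith [min_le_left (1 / 2 : ℝ) (δ / (C + 1))], ?_⟩
    calc min (1 / 2) (δ / (C + 1)) * C ≤ δ / (C + 1) * (C + 1) := by
          gcongr
          · exact min_le_right _ _
          · linarith
      _ = δ := by field_simp
  have hcontr : ContractingWith (Real.toNNReal (1 - t)) fun x => (1 - t) • f x := by
    refine ⟨by rw [← NNReal.coe_lt_coe, Real.coe_toNNReal _ (by linarith)]; simpa using ht0,
      LipschitzWith.of_dist_le_mul fun x y => ?_⟩
    rw [Real.coe_toNNReal _ (by linarith), dist_eq_norm, dist_eq_norm, ← smul_sub, norm_smul,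
      Real.norm_of_nonneg (by linarith)]
    exact mul_le_mul_of_nonneg_left (hf x y) (by linarith)
  set y := ContractingWith.fixedPoint _ hcontr with hy
  have hyfix : (1 - t) • f y = y := hcontr.fixedPoint_isFixedPt
  have hyC : y ∈ Metric.closedBall (0 : E) C := by
    rw [mem_closedBall_zero_iff, ← hyfix, norm_smul, Real.norm_of_nonneg (by linarith)]
    nlinarith [hC y, norm_nonneg (f y)]
  have h1 : f y - y = t • f y := by
    nth_rewrite 2 [← hyfix]
    module
  calc ‖f x - x‖ ≤ ‖f y - y‖ := hx hyC
    _ = t * ‖f y‖ := by rw [h1, norm_smul, Real.norm_of_nonneg ht0.le]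
    _ ≤ t * C := mul_le_mul_of_nonneg_left (hC y) ht0.le
    _ ≤ 0 + δ := by linarith

/-- The distance from `u` to the nearest even integer. -/
def wave (u : ℝ) : ℝ := 2 * |u / 2 - round (u / 2)|

theorem wave_nonneg (u : ℝ) : 0 ≤ wave u := by unfold wave; positivity

theorem wave_le_one (u : ℝ) : wave u ≤ 1 := by
  have := abs_sub_round (u / 2)
  unfold wave
  linarith

theorem wave_sub_le (u v : ℝ) : wave u - wave v ≤ |u - v| := by
  have h1 := round_le (u / 2) (round (v / 2))
  have h2 : |u / 2 - round (v / 2)| ≤ |u / 2 - v / 2| + |v / 2 - round (v / 2)| :=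
    abs_sub_le _ _ _
  have h3 : |u / 2 - v / 2| = |u - v| / 2 := by
    rw [← sub_div, abs_div]; norm_num
  unfold wave
  linarith

theorem abs_wave_sub_le (u v : ℝ) : |wave u - wave v| ≤ |u - v| :=
  abs_sub_le_iff.2 ⟨wave_sub_le u v, abs_sub_comm u v ▸ wave_sub_le v u⟩

variable {r s : ℕ}

/-- Put `m = D̂ l`. The vector `D̂ᵀ m = (-M m, m)` lies in `ker D`, and its inner product with `l`
is `m ⬝ᵥ m`. -/
theorem mulVec_dualMatrix_eq_zero {M : Matrix (Fin r) (Fin s) ℤ} {l : Fin r ⊕ Fin s → ℝ}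
    (h : ∀ k, realMat (stdMatrix M) *ᵥ k = 0 → k ⬝ᵥ l = 0) :
    realMat (dualMatrix M) *ᵥ l = 0 := by
  set m := realMat (dualMatrix M) *ᵥ l with hm
  have h1 := h (Sum.elim (-(realMat M *ᵥ m)) m) (by rw [realMat_stdMatrix_mulVec]; simp)
  have h2 : Sum.elim (-(realMat M *ᵥ m)) m ⬝ᵥ l
      = -((realMat M *ᵥ m) ⬝ᵥ (l ∘ Sum.inl)) + m ⬝ᵥ (l ∘ Sum.inr) := by
    simp [dotProduct]
  have h3 : m ⬝ᵥ m = m ⬝ᵥ (-((realMat M)ᵀ *ᵥ (l ∘ Sum.inl)) + l ∘ Sum.inr) := by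
    rw [← realMat_dualMatrix_mulVec, ← hm]
  rw [dotProduct_add, dotProduct_neg, Matrix.dotProduct_mulVec m (realMat M)ᵀ,
    Matrix.vecMul_transpose, ← h2,
    h1] at h3
  exact dotProduct_self_eq_zero.1 h3

theorem eq_zero_of_mem_ker {M : Matrix (Fin r) (Fin s) ℤ} {k : Fin r ⊕ Fin s → ℝ}
    (h₁ : realMat (stdMatrix M) *ᵥ k = 0) (h₂ : realMat (dualMatrix M) *ᵥ k = 0) : k = 0 :=
  dotProduct_self_eq_zero.1 (dotProduct_eq_zero_of_mem_ker h₁ h₂)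

theorem exists_mulVec_eq (M : Matrix (Fin r) (Fin s) ℤ) (x : Fin r → ℝ) (y : Fin s → ℝ) :
    ∃ c, realMat (stdMatrix M) *ᵥ c = x ∧ realMat (dualMatrix M) *ᵥ c = y := by
  have hinj : Function.Injective
      (Matrix.fromRows (realMat (stdMatrix M)) (realMat (dualMatrix M))).mulVecLin := by
    rw [injective_iff_map_eq_zero]
    intro k hk
    rw [Matrix.mulVecLin_apply, Matrix.fromRows_mulVec] at hk
    refine eq_zero_of_mem_ker (M := M) ?_ ?_
    · ext i; simpa using congrFun hk (Sum.inl i)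
    · ext i; simpa using congrFun hk (Sum.inr i)
  obtain ⟨c, hc⟩ := LinearMap.injective_iff_surjective.1 hinj (Sum.elim x y)
  rw [Matrix.mulVecLin_apply, Matrix.fromRows_mulVec] at hc
  refine ⟨c, ?_, ?_⟩
  · ext i; simpa using congrFun hc (Sum.inl i)
  · ext i; simpa using congrFun hc (Sum.inr i)

/-- The two affine subspaces `D p = x` and `D̂ q = y` meet the staircases. -/
theorem exists_mem_staircase (M : Matrix (Fin r) (Fin s) ℤ) (x : Fin r → ℝ) (y : Fin s → ℝ) :
    ∃ u : Fin r ⊕ Fin s → ℝ,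
      realMat (stdMatrix M) *ᵥ (fun j => (u j + wave (u j)) / 2) = x ∧
      realMat (dualMatrix M) *ᵥ (fun j => (u j - wave (u j)) / 2) = y := by
  obtain ⟨c, hc₁, hc₂⟩ := exists_mulVec_eq M x y
  let E := EuclideanSpace ℝ (Fin r ⊕ Fin s)
  let K : Submodule ℝ E := LinearMap.ker
    ((realMat (stdMatrix M)).mulVecLin ∘ₗ (WithLp.linearEquiv 2 ℝ _).toLinearMap)
  let G : E → E := fun u => WithLp.toLp 2 fun j => wave (u j)
  let c' : E := WithLp.toLp 2 c
  -- With `K = ker D` and `π` its orthogonal projection, it suffices to have `p = c + π G` and `q =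
  -- c - (G - π G)`, where `G = p - q`. Their sum is `u = 2 c + (2 π - 1) G`, and `2 π - 1` is the
  -- reflection, an isometry.
  obtain ⟨u, hu⟩ : ∃ u, (2 : ℝ) • c' + K.reflection (G u) = u := by
    refine exists_fixedPoint_of_nonexpansive (C := ‖(2 : ℝ) • c'‖ + √(Fintype.card (Fin r ⊕ Fin s)))
      (f := fun u => (2 : ℝ) • c' + K.reflection (G u)) (fun a b => ?_) fun a => ?_
    · rw [add_sub_add_left_eq_sub, ← map_sub, LinearIsometryEquiv.norm_map,
        EuclideanSpace.norm_eq, EuclideanSpace.norm_eq]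
      refine Real.sqrt_le_sqrt (Finset.sum_le_sum fun j _ => ?_)
      have := abs_wave_sub_le (a j) (b j)
      rw [Real.norm_eq_abs, Real.norm_eq_abs]
      exact pow_le_pow_left₀ (abs_nonneg _) this 2
    · refine (norm_add_le _ _).trans ?_
      gcongr
      rw [LinearIsometryEquiv.norm_map, EuclideanSpace.norm_eq]
      refine Real.sqrt_le_sqrt ?_
      calc ∑ j, ‖G a j‖ ^ 2 ≤ ∑ _j : Fin r ⊕ Fin s, (1 : ℝ) := by
            refine Finset.sum_le_sum fun j _ => ?_
            have h0 := wave_nonneg (a j)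
            have h1 := wave_le_one (a j)
            simp only [G, Real.norm_eq_abs, sq_abs]
            nlinarith
        _ = _ := by simp
  have hproj : K.reflection (G u) = (2 : ℝ) • K.starProjection (G u) - G u := by
    rw [Submodule.reflection_apply, two_smul, two_smul]
  have hcoord : ∀ j, 2 * c j + (2 * K.starProjection (G u) j - wave (u j)) = u j := by
    intro j
    rw [hproj] at hu
    exact congrArg (fun v : E => v j) hu
  have hp : (fun j => (u j + wave (u j)) / 2) = c + (K.starProjection (G u)).ofLp := by
    ext j
    have := hcoord j
    change (u j + wave (u j)) / 2 = c j + K.starProjection (G u) j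
    linarith
  have hq : (fun j => (u j - wave (u j)) / 2) = c - (G u - K.starProjection (G u)).ofLp := by
    ext j
    have := hcoord j
    change (u j - wave (u j)) / 2 = c j - (wave (u j) - K.starProjection (G u) j)
    linarith
  refine ⟨u.ofLp, ?_, ?_⟩
  · have hmem : K.starProjection (G u) ∈ K := Submodule.starProjection_apply_mem _ _
    have h0 : realMat (stdMatrix M) *ᵥ (K.starProjection (G u)).ofLp = 0 := hmem
    rw [hp, Matrix.mulVec_add, hc₁, h0, add_zero]
  · have h0 : realMat (dualMatrix M) *ᵥ (G u - K.starProjection (G u)).ofLp = 0 := by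
      refine mulVec_dualMatrix_eq_zero fun k hk => ?_
      have hperp := K.sub_starProjection_mem_orthogonal (G u)
      have := (Submodule.mem_orthogonal _ _).1 hperp (WithLp.toLp 2 k) hk
      rw [EuclideanSpace.inner_eq_star_dotProduct] at this
      simpa [dotProduct_comm] using this
    rw [hq, Matrix.mulVec_sub, hc₂, h0, sub_zero]

/-! ### The tiling of `ℝⁿ` by the translates of the `P(B)` -/

/-- The vector `(D Z, -D̂ Z)` of the translation lattice. -/
def latt (M : Matrix (Fin r) (Fin s) ℤ) (Z : Fin r ⊕ Fin s → ℤ) : Fin r ⊕ Fin s → ℝ :=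
  Sum.elim (toReal (stdMatrix M *ᵥ Z)) (-toReal (dualMatrix M *ᵥ Z))

theorem prodMatrix_mulVec (M : Matrix (Fin r) (Fin s) ℤ) (B : Finset (Fin r ⊕ Fin s))
    (a : Fin r ⊕ Fin s → ℝ) :
    prodMatrix M B *ᵥ a = Sum.elim (realMat (stdMatrix M) *ᵥ fun j => if j ∈ B then a j else 0)
      (realMat (dualMatrix M) *ᵥ fun j => if j ∈ B then 0 else a j) := by
  ext (i | i) <;> simp [prodMatrix, Matrix.mulVec, dotProduct, ite_mul, mul_ite]

/-- The set `B` read off from the staircase need not be a basis, nor even have `r` elements;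
degenerate cells are discarded later. -/
theorem exists_mem_cell (M : Matrix (Fin r) (Fin s) ℤ) (v : Fin r ⊕ Fin s → ℝ) :
    ∃ B Z, v - latt M Z ∈ P M B := by
  obtain ⟨u, hu₁, hu₂⟩ := exists_mem_staircase M (v ∘ Sum.inl) (-(v ∘ Sum.inr))
  -- The corner `(Z, Z)` of the staircase has parameter `u = 2 Z`. Past the nearest corner the step
  -- is horizontal, before it vertical, and `wave u` is the distance travelled along the step.
  let B : Finset (Fin r ⊕ Fin s) := Finset.univ.filter fun j => 0 ≤ u j / 2 - round (u j / 2)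
  refine ⟨B, fun j => round (u j / 2), ?_⟩
  rw [P_eq_fundPar]
  refine ⟨fun j => wave (u j), fun j => ⟨wave_nonneg _, wave_le_one _⟩, ?_⟩
  have h₁ : (fun j => (u j + wave (u j)) / 2) = toReal (fun j => round (u j / 2))
      + fun j => if j ∈ B then wave (u j) else 0 := by
    ext j
    simp only [Pi.add_apply, toReal, B, Finset.mem_filter, Finset.mem_univ, true_and]
    split_ifs with h
    · rw [wave, abs_of_nonneg h]; ring
    · rw [wave, abs_of_neg (not_le.1 h)]; ring
  have h₂ : (fun j => (u j - wave (u j)) / 2) = toReal (fun j => round (u j / 2))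
      - fun j => if j ∈ B then 0 else wave (u j) := by
    ext j
    simp only [Pi.sub_apply, toReal, B, Finset.mem_filter, Finset.mem_univ, true_and]
    split_ifs with h
    · rw [wave, abs_of_nonneg h]; ring
    · rw [wave, abs_of_neg (not_le.1 h)]; ring
  rw [h₁, Matrix.mulVec_add] at hu₁
  rw [h₂, Matrix.mulVec_sub] at hu₂
  rw [prodMatrix_mulVec]
  ext (i | i)
  · have := congrFun hu₁ i
    simp only [latt, toReal_mulVec, Pi.sub_apply, Sum.elim_inl, Pi.add_apply,
      Function.comp_apply] at this ⊢
    linarith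
  · have := congrFun hu₂ i
    simp only [latt, toReal_mulVec, Pi.sub_apply, Sum.elim_inr, Pi.neg_apply,
      Function.comp_apply] at this ⊢
    linarith

end Existence

section Frames

variable {r s : ℕ}

/-! ### Complementary minors -/

/-- Jacobi's complementary minor identity: completing `D` and `D̂` to unimodular matrices `U` and
`V` gives `U Vᵀ = 1`, which survives a common reordering of the columns. -/
theorem natAbs_det_frame₂ (M : Matrix (Fin r) (Fin s) ℤ) (e : Fin r ⊕ Fin s ≃ Fin r ⊕ Fin s) :
    (frame₂ M e).det.natAbs = (frame₁ M e).det.natAbs := by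
  let U : Matrix (Fin r ⊕ Fin s) (Fin r ⊕ Fin s) ℤ := Matrix.fromBlocks 1 M 0 1
  let V : Matrix (Fin r ⊕ Fin s) (Fin r ⊕ Fin s) ℤ := Matrix.fromBlocks 1 0 (-Mᵀ) 1
  let X := U.submatrix id e
  let W := V.submatrix id e
  have hXW : X * Wᵀ = 1 := by
    have h := Matrix.submatrix_mul_equiv U Vᵀ id e id
    simp only [X, W, Matrix.transpose_submatrix]
    rw [h]
    simp [U, V, Matrix.fromBlocks_transpose, Matrix.fromBlocks_multiply]
  have hX : X.det.natAbs = 1 := by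
    have := congrArg Matrix.det hXW
    rw [Matrix.det_mul, Matrix.det_one] at this
    exact Int.isUnit_iff_natAbs_eq.1 (IsUnit.of_mul_eq_one _ this)
  have h₁ : X.toBlocks₁₁ = frame₁ M e := by
    ext i j
    simp only [X, U, frame₁, Matrix.toBlocks₁₁, Matrix.of_apply, Matrix.submatrix_apply, id,
      Function.comp_apply]
    rcases e (Sum.inl j) with k | k <;> simp [stdMatrix]
  have h₂ : W.toBlocks₂₂ = frame₂ M e := by
    ext i j
    simp only [W, V, frame₂, Matrix.toBlocks₂₂, Matrix.of_apply, Matrix.submatrix_apply, id,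
      Function.comp_apply]
    rcases e (Sum.inr j) with k | k <;> simp [dualMatrix]
  have hblocks := hXW
  rw [← Matrix.fromBlocks_toBlocks X, ← Matrix.fromBlocks_toBlocks W,
    Matrix.fromBlocks_transpose, Matrix.fromBlocks_multiply, ← Matrix.fromBlocks_one,
    Matrix.fromBlocks_inj] at hblocks
  obtain ⟨-, h12, -, h22⟩ := hblocks
  -- Replacing the first block column of `Wᵀ` by that of the identity leaves both sides block
  -- triangular apart from `X`, so determinants compare the two minors directly.
  have hprod : X * Matrix.fromBlocks 1 W.toBlocks₂₁ᵀ 0 W.toBlocks₂₂ᵀ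
      = Matrix.fromBlocks X.toBlocks₁₁ 0 X.toBlocks₂₁ 1 := by
    conv_lhs => rw [← Matrix.fromBlocks_toBlocks X]
    rw [Matrix.fromBlocks_multiply, h12, h22]
    simp
  have hdet := congrArg Matrix.det hprod
  rw [Matrix.det_mul, Matrix.det_fromBlocks_zero₂₁, Matrix.det_fromBlocks_zero₁₂, Matrix.det_one,
    Matrix.det_one, one_mul, mul_one, Matrix.det_transpose, h₁, h₂] at hdet
  rw [← hdet, Int.natAbs_mul, hX, one_mul]

/-! ### Frames of bases -/

/-- `e` lists the elements of `B` first. -/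
structure IsFrame (M : Matrix (Fin r) (Fin s) ℤ) (B : Finset (Fin r ⊕ Fin s))
    (e : Fin r ⊕ Fin s ≃ Fin r ⊕ Fin s) : Prop where
  isLeft_iff : ∀ j, (e.symm j).isLeft = true ↔ j ∈ B
  natAbs_det₁ : (frame₁ M e).det.natAbs = mult M B
  natAbs_det₂ : (frame₂ M e).det.natAbs = mult M B
  P₁_eq : P₁ M B = fundPar (realMat (frame₁ M e))
  P₂_eq : P₂ M B = fundPar (realMat (frame₂ M e))

theorem exists_isFrame (M : Matrix (Fin r) (Fin s) ℤ) {B : Finset (Fin r ⊕ Fin s)}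
    (h : B.card = r) : ∃ e, IsFrame M B e := by
  have hc : Fintype.card {j // j ∉ B} = s := by
    rw [Fintype.card_subtype_compl]
    simp [h]
  let e₁ := (B.equivFinOfCardEq h).symm
  let e₂ := (Fintype.equivFinOfCardEq hc).symm
  let e := (Equiv.sumCongr e₁ e₂).trans (Equiv.sumCompl (· ∈ B))
  have hdet : (frame₁ M e).det.natAbs = mult M B := by
    rw [mult, colDet, dif_pos h]
    rfl
  refine ⟨e, fun j => ?_, hdet, (natAbs_det_frame₂ M e).trans hdet, ?_, ?_⟩
  · obtain ⟨i | i, rfl⟩ := e.surjective j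
    · rw [Equiv.symm_apply_apply]
      exact iff_of_true rfl (e₁ i).2
    · rw [Equiv.symm_apply_apply]
      exact iff_of_false Bool.false_ne_true (e₂ i).2
  · exact (fundPar_submatrix_equiv _ e₁).symm
  · exact (fundPar_submatrix_equiv _ e₂).symm

theorem IsFrame.mem_inl {M : Matrix (Fin r) (Fin s) ℤ} {B : Finset (Fin r ⊕ Fin s)}
    {e : Fin r ⊕ Fin s ≃ Fin r ⊕ Fin s} (he : IsFrame M B e) (i : Fin r) :
    e (Sum.inl i) ∈ B := by
  rw [← he.isLeft_iff]; simp

theorem IsFrame.notMem_inr {M : Matrix (Fin r) (Fin s) ℤ} {B : Finset (Fin r ⊕ Fin s)}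
    {e : Fin r ⊕ Fin s ≃ Fin r ⊕ Fin s} (he : IsFrame M B e) (i : Fin s) :
    e (Sum.inr i) ∉ B := by
  rw [← he.isLeft_iff]; simp

theorem IsFrame.prodMatrix_mulVec {M : Matrix (Fin r) (Fin s) ℤ} {B : Finset (Fin r ⊕ Fin s)}
    {e : Fin r ⊕ Fin s ≃ Fin r ⊕ Fin s} (he : IsFrame M B e) (a : Fin r ⊕ Fin s → ℝ) :
    prodMatrix M B *ᵥ a = Sum.elim (realMat (frame₁ M e) *ᵥ (a ∘ e ∘ Sum.inl))
      (realMat (frame₂ M e) *ᵥ (a ∘ e ∘ Sum.inr)) := by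
  have h₁ : (fun j => if j ∈ B then a j else 0) = Sum.elim (a ∘ e ∘ Sum.inl) 0 ∘ e.symm := by
    ext j
    obtain ⟨i | i, rfl⟩ := e.surjective j
    · simp [he.mem_inl]
    · simp [he.notMem_inr]
  have h₂ : (fun j => if j ∈ B then 0 else a j)
      = Sum.elim (0 : Fin r → ℝ) (a ∘ e ∘ Sum.inr) ∘ e.symm := by
    ext j
    obtain ⟨i | i, rfl⟩ := e.surjective j
    · simp [he.mem_inl]
    · simp [he.notMem_inr]
  rw [StdRep.prodMatrix_mulVec, h₁, h₂, mulVec_elim_left, mulVec_elim_right]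
  rfl

/-- Surjectivity onto the two factors needs at least `r` columns in `B` and `s` outside it, which
fixes `B.card`; then the block of `D` on `B` is square and onto. -/
theorem isBasis_of_surjective {M : Matrix (Fin r) (Fin s) ℤ} {B : Finset (Fin r ⊕ Fin s)}
    (hsurj : Function.Surjective (prodMatrix M B).mulVecLin) : IsBasis M B := by
  have hle₁ : r ≤ B.card := by
    have := LinearMap.finrank_le_finrank_of_surjective
      (f := (Matrix.of fun (i : Fin r) (j : {j // j ∈ B}) => (stdMatrix M i j.1 : ℝ)).mulVecLin)
      fun x => by
        obtain ⟨a, ha⟩ := hsurj (Sum.elim x 0)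
        exact ⟨fun j => a j.1, funext fun i => (prodMatrix_mulVec_inl M B a i).symm.trans
          (congrFun ha (Sum.inl i))⟩
    simpa using this
  have hle₂ : s ≤ r + s - B.card := by
    have := LinearMap.finrank_le_finrank_of_surjective
      (f := (Matrix.of fun (i : Fin s) (j : {j // j ∉ B}) => (dualMatrix M i j.1 : ℝ)).mulVecLin)
      fun x => by
        obtain ⟨a, ha⟩ := hsurj (Sum.elim 0 x)
        exact ⟨fun j => a j.1, funext fun i => (prodMatrix_mulVec_inr M B a i).symm.trans
          (congrFun ha (Sum.inr i))⟩
    simpa [Fintype.card_subtype_compl] using this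
  have hcard : B.card ≤ r + s := by simpa using B.card_le_univ
  have h : B.card = r := by omega
  refine ⟨h, ?_⟩
  obtain ⟨e, he⟩ := exists_isFrame M h
  have hs : Function.Surjective (realMat (frame₁ M e)).mulVec := by
    intro x
    obtain ⟨a, ha⟩ := hsurj (Sum.elim x 0)
    rw [Matrix.mulVecLin_apply, he.prodMatrix_mulVec] at ha
    exact ⟨_, funext fun i => congrFun ha (Sum.inl i)⟩
  have hu := (Matrix.isUnit_iff_isUnit_det _).1 (Matrix.mulVec_surjective_iff_isUnit.1 hs)
  rw [det_realMat, isUnit_iff_ne_zero] at hu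
  rw [← Int.natAbs_ne_zero]
  change mult M B ≠ 0
  rw [← he.natAbs_det₁, Int.natAbs_ne_zero]
  exact_mod_cast hu

/-! ### The tiling with bases only -/

theorem isCompact_P (M : Matrix (Fin r) (Fin s) ℤ) (B : Finset (Fin r ⊕ Fin s)) :
    IsCompact (P M B) := P_eq_fundPar M B ▸ isCompact_fundPar _

theorem convex_P (M : Matrix (Fin r) (Fin s) ℤ) (B : Finset (Fin r ⊕ Fin s)) :
    Convex ℝ (P M B) := P_eq_fundPar M B ▸ convex_fundPar _

/-- The map `Z ↦ (D Z, D̂ Z)` is injective with integer values, and a bounded box has finitely many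
integer points. -/
theorem finite_latt_le (M : Matrix (Fin r) (Fin s) ℤ) (R : ℝ) :
    {Z | ‖latt M Z‖ ≤ R}.Finite := by
  let f : (Fin r ⊕ Fin s → ℤ) → (Fin r → ℤ) × (Fin s → ℤ) := fun Z =>
    (stdMatrix M *ᵥ Z, dualMatrix M *ᵥ Z)
  have hf : Function.Injective f := by
    intro Z Z' h
    have h₁ : stdMatrix M *ᵥ (Z - Z') = 0 := by
      rw [Matrix.mulVec_sub, sub_eq_zero]; exact congrArg Prod.fst h
    have h₂ : dualMatrix M *ᵥ (Z - Z') = 0 := by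
      rw [Matrix.mulVec_sub, sub_eq_zero]; exact congrArg Prod.snd h
    have h0 : toReal (Z - Z') = 0 := by
      refine eq_zero_of_mem_ker (M := M) ?_ ?_
      · rw [← toReal_mulVec, h₁]; ext; simp [toReal]
      · rw [← toReal_mulVec, h₂]; ext; simp [toReal]
    exact toReal_injective (sub_eq_zero.1 (by rw [← toReal_sub, h0]))
  refine (((finite_Icc (fun _ => -⌈R⌉) (fun _ => ⌈R⌉)).prod
    (finite_Icc (fun _ => -⌈R⌉) (fun _ => ⌈R⌉))).preimage hf.injOn).subset fun Z hZ => ?_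
  have hcoord : ∀ j, |latt M Z j| ≤ ⌈R⌉ := fun j =>
    ((norm_le_pi_norm (latt M Z) j).trans hZ).trans (Int.le_ceil R)
  have h₁ : ∀ i, |(stdMatrix M *ᵥ Z) i| ≤ ⌈R⌉ := fun i => by
    have := hcoord (Sum.inl i)
    simp only [latt, Sum.elim_inl, toReal] at this
    exact_mod_cast this
  have h₂ : ∀ i, |(dualMatrix M *ᵥ Z) i| ≤ ⌈R⌉ := fun i => by
    have := hcoord (Sum.inr i)
    simp only [latt, Sum.elim_inr, Pi.neg_apply, toReal, abs_neg] at this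
    exact_mod_cast this
  exact ⟨⟨fun i => (abs_le.1 (h₁ i)).1, fun i => (abs_le.1 (h₁ i)).2⟩,
    ⟨fun i => (abs_le.1 (h₂ i)).1, fun i => (abs_le.1 (h₂ i)).2⟩⟩

theorem finite_cells_meeting_ball (M : Matrix (Fin r) (Fin s) ℤ) (R : ℝ) :
    {c : Finset (Fin r ⊕ Fin s) × (Fin r ⊕ Fin s → ℤ) |
      ∃ v, ‖v‖ ≤ R ∧ v - latt M c.2 ∈ P M c.1}.Finite := by
  obtain ⟨C, hC⟩ := (Bornology.isBounded_iUnion.2 fun B => (isCompact_P M B).isBounded).exists_norm_le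
  refine (finite_univ.prod (finite_latt_le M (R + C))).subset ?_
  rintro ⟨B, Z⟩ ⟨v, hv, hP⟩
  refine ⟨mem_univ _, ?_⟩
  have h := hC _ (mem_iUnion.2 ⟨B, hP⟩)
  calc ‖latt M Z‖ = ‖v - (v - latt M Z)‖ := by rw [sub_sub_cancel]
    _ ≤ ‖v‖ + ‖v - latt M Z‖ := norm_sub_le _ _
    _ ≤ R + C := add_le_add hv h

/-- A cell of a non-basis is the image of a cube under a singular map, hence null, and there are
countably many cells. Almost every point therefore lies only in cells of bases. -/
theorem dense_iUnion_basis_cells (M : Matrix (Fin r) (Fin s) ℤ) :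
    Dense {v | ∃ B Z, IsBasis M B ∧ v - latt M Z ∈ P M B} := by
  refine MeasureTheory.Measure.dense_of_ae (μ := MeasureTheory.volume) ?_
  have hnull : ∀ c : Finset (Fin r ⊕ Fin s) × (Fin r ⊕ Fin s → ℤ), ¬ IsBasis M c.1 →
      ∀ᵐ v : Fin r ⊕ Fin s → ℝ, v - latt M c.2 ∉ P M c.1 := by
    rintro ⟨B, Z⟩ hB
    have h0 : MeasureTheory.volume (P M B) = 0 := by
      rw [P_eq_fundPar, fundPar_eq_image, MeasureTheory.Measure.addHaar_image_linearMap]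
      have : LinearMap.det (prodMatrix M B).mulVecLin = 0 := by
        by_contra hne
        exact hB (isBasis_of_surjective
          (LinearMap.equivOfDetNeZero _ hne).surjective)
      simp [this]
    have hshift := (MeasureTheory.measurePreserving_sub_right MeasureTheory.volume
      (latt M Z)).quasiMeasurePreserving.ae (p := fun v => v ∉ P M B)
      (MeasureTheory.measure_eq_zero_iff_ae_notMem.1 h0)
    exact hshift
  have hall : ∀ᵐ v : Fin r ⊕ Fin s → ℝ, ∀ c : Finset (Fin r ⊕ Fin s) × (Fin r ⊕ Fin s → ℤ),
      ¬ IsBasis M c.1 → v - latt M c.2 ∉ P M c.1 :=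
    MeasureTheory.ae_all_iff.2 fun c => by
      by_cases hc : IsBasis M c.1
      · simp [hc]
      · simpa [hc] using hnull c hc
  filter_upwards [hall] with v hv
  obtain ⟨B, Z, hBZ⟩ := exists_mem_cell M v
  refine ⟨B, Z, ?_, hBZ⟩
  by_contra hB
  exact hv (B, Z) hB hBZ

/-- Only finitely many cells meet a ball around `v`, so one basis cell contains points arbitrarily
near `v`; it is closed. -/
theorem exists_mem_basis_cell (M : Matrix (Fin r) (Fin s) ℤ) (v : Fin r ⊕ Fin s → ℝ) :
    ∃ B Z, IsBasis M B ∧ v - latt M Z ∈ P M B := by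
  have hfreq : ∃ᶠ u in 𝓝 v, ∃ B Z, IsBasis M B ∧ u - latt M Z ∈ P M B :=
    mem_closure_iff_frequently.1 (dense_iUnion_basis_cells M v)
  have hball : ∀ᶠ u in 𝓝 v, ‖u‖ ≤ ‖v‖ + 1 :=
    (continuous_norm.tendsto v).eventually (eventually_le_nhds (by linarith))
  have hfin := (frequently_exists_finite (finite_cells_meeting_ball M (‖v‖ + 1))
    (p := fun c u => IsBasis M c.1 ∧ u - latt M c.2 ∈ P M c.1) (l := 𝓝 v)).1 <|
    (hfreq.and_eventually hball).mono fun u ⟨⟨B, Z, hB, hu⟩, hn⟩ => ⟨(B, Z), ⟨u, hn, hu⟩, hB, hu⟩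
  obtain ⟨⟨B, Z⟩, -, h⟩ := hfin
  have hB : IsBasis M B := h.exists.choose_spec.1
  refine ⟨B, Z, hB, (isCompact_P M B).isClosed.mem_of_frequently_of_tendsto
    (h.mono fun u hu => hu.2) ?_⟩
  exact (continuous_id.sub continuous_const).tendsto v

/-- Every point, moved slightly in a given direction, stays in a single cell. -/
theorem exists_assoc_cell (M : Matrix (Fin r) (Fin s) ℤ) (v w : Fin r ⊕ Fin s → ℝ) :
    ∃ B Z, IsBasis M B ∧ Assoc w (P M B) (v - latt M Z) := by
  have hball : ∀ᶠ ε : ℝ in 𝓝[>] 0, ‖v + ε • w‖ ≤ ‖v‖ + 1 := by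
    have hcont : Continuous fun ε : ℝ => ‖v + ε • w‖ := by fun_prop
    refine nhdsWithin_le_nhds ((hcont.tendsto 0).eventually (eventually_le_nhds ?_))
    simp
  have hfin := (frequently_exists_finite (finite_cells_meeting_ball M (‖v‖ + 1))
    (p := fun c (ε : ℝ) => IsBasis M c.1 ∧ v + ε • w - latt M c.2 ∈ P M c.1) (l := 𝓝[>] 0)).1 <|
    (hball.mono fun ε hn => by
      obtain ⟨B, Z, hB, hu⟩ := exists_mem_basis_cell M (v + ε • w)
      exact ⟨(B, Z), ⟨_, hn, hu⟩, hB, hu⟩).frequently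
  obtain ⟨⟨B, Z⟩, -, h⟩ := hfin
  have hB : IsBasis M B := h.exists.choose_spec.1
  refine ⟨B, Z, hB, assoc_of_frequently (isCompact_P M B).isClosed (convex_P M B)
    (h.mono fun ε hε => ?_)⟩
  rw [sub_add_eq_add_sub]
  exact hε.2

/-- The coordinates of a shifting vector in the frame of a basis do not vanish. -/
theorem IsShiftingVector.coord_ne_zero {M : Matrix (Fin r) (Fin s) ℤ}
    {w : Fin r → ℝ} {wh : Fin s → ℝ} (hw : IsShiftingVector M (Sum.elim w wh))
    {B : Finset (Fin r ⊕ Fin s)} (hB : IsBasis M B)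
    {a : Fin r ⊕ Fin s → ℝ} (ha : prodMatrix M B *ᵥ a = Sum.elim w wh)
    (k : Fin r ⊕ Fin s) : a k ≠ 0 := by
  intro hk
  -- If `a k = 0`, the vector is a combination of the columns other than `k`, each a difference of
  -- two vertices of the facet with `k`-th coordinate `0`.
  refine hw B hB k 0 (Or.inl rfl) ?_
  rw [← ha, Matrix.mulVec_eq_sum]
  refine Submodule.sum_mem _ fun j _ => ?_
  by_cases hj : j = k
  · simp [hj, hk]
  · rw [op_smul_eq_smul]
    refine Submodule.smul_mem _ _ ?_
    have h₁ : (prodMatrix M B)ᵀ j ∈ facet (prodMatrix M B) k 0 := by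
      refine ⟨Pi.single j 1, fun i => ?_, Pi.single_eq_of_ne (Ne.symm hj) _, ?_⟩
      · by_cases h : i = j
        · subst h; simp
        · simp [h]
      · ext i; simp
    have h₂ : (0 : Fin r ⊕ Fin s → ℝ) ∈ facet (prodMatrix M B) k 0 :=
      ⟨0, fun i => by simp, rfl, by simp⟩
    simpa using vsub_mem_vectorSpan ℝ h₁ h₂

end Frames

section ProductTiling

/-! ### From the tiling of `ℝⁿ` to a tile in one of the factors -/

theorem mem_translate {ι : Type*} {Q : Set (ι → ℝ)} {v x : ι → ℝ} :
    x ∈ translate Q v ↔ x - v ∈ Q := by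
  constructor
  · rintro ⟨y, hy, rfl⟩
    simpa using hy
  · intro h
    exact ⟨x - v, h, by simp⟩

/-- A point of `R` interior to `Q` is a limit of some `N`, so `N` meets `Q` at a point that is a
limit of some `O`; as `N` is open, it meets `O`. -/
theorem meetAtBoundary_of_disjoint {ι : Type*} {Q R : Set (ι → ℝ)} {𝒪 𝒩 : Set (Set (ι → ℝ))}
    (h𝒪 : ∀ O ∈ 𝒪, IsOpen O) (h𝒩 : ∀ O ∈ 𝒩, IsOpen O)
    (hQ : ∀ x ∈ Q, ∃ O ∈ 𝒪, x ∈ closure O) (hR : ∀ x ∈ R, ∃ O ∈ 𝒩, x ∈ closure O)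
    (hdisj : ∀ O ∈ 𝒪, ∀ N ∈ 𝒩, ∀ x ∈ O, x ∉ N) : MeetAtBoundary Q R := by
  rintro x ⟨hxQ, hxR⟩
  refine ⟨⟨subset_closure hxQ, fun hx => ?_⟩, ⟨subset_closure hxR, fun hx => ?_⟩⟩
  · obtain ⟨N, hN, hxN⟩ := hR x hxR
    obtain ⟨y, hyQ, hyN⟩ := mem_closure_iff.1 hxN _ isOpen_interior hx
    obtain ⟨O, hO, hyO⟩ := hQ y (interior_subset hyQ)
    obtain ⟨z, hzN, hzO⟩ := mem_closure_iff.1 hyO _ (h𝒩 N hN) hyN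
    exact hdisj O hO N hN z hzO hzN
  · obtain ⟨O, hO, hxO⟩ := hQ x hxQ
    obtain ⟨y, hyR, hyO⟩ := mem_closure_iff.1 hxO _ isOpen_interior hx
    obtain ⟨N, hN, hyN⟩ := hR y (interior_subset hyR)
    obtain ⟨z, hzO, hzN⟩ := mem_closure_iff.1 hyN _ (h𝒪 O hO) hyO
    exact hdisj O hO N hN z hzO hzN

variable {β ρ σ : Type*} [Fintype ρ] [DecidableEq ρ] [Fintype σ] [DecidableEq σ]

/-- The data of a tiling of a product by the cells `(Q b × H b) + (l u + τ v, -v)`, where `Q b` and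
`H b` are the parallelepipeds of the integer matrices `E b` and `F b` of determinant `± m b`: open
cells are disjoint, and the closed ones cover the slice in the direction of `wh`. -/
structure IsProductTiling (𝓑 : Set β) (Q : β → Set (ρ → ℝ)) (H : β → Set (σ → ℝ))
    (E : β → Matrix ρ ρ ℤ) (F : β → Matrix σ σ ℤ) (m : β → ℕ)
    (l : (ρ → ℤ) → ρ → ℝ) (τ : (σ → ℤ) → ρ → ℝ) (w : ρ → ℝ) (wh : σ → ℝ) : Prop where
  Q_eq : ∀ b ∈ 𝓑, Q b = fundPar (realMat (E b))
  H_eq : ∀ b ∈ 𝓑, H b = fundPar (realMat (F b))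
  natAbs_det_E : ∀ b ∈ 𝓑, (E b).det.natAbs = m b
  natAbs_det_F : ∀ b ∈ 𝓑, (F b).det.natAbs = m b
  m_ne_zero : ∀ b ∈ 𝓑, m b ≠ 0
  coord_w : ∀ b ∈ 𝓑, ∀ j, ((realMat (E b))⁻¹ *ᵥ w) j ≠ 0
  coord_wh : ∀ b ∈ 𝓑, ∀ j, ((realMat (F b))⁻¹ *ᵥ wh) j ≠ 0
  l_zero : l 0 = 0
  τ_int : ∀ v, ∃ n : ρ → ℤ, τ v = toReal n
  disjoint : ∀ b ∈ 𝓑, ∀ b' ∈ 𝓑, ∀ x y u v u' v',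
    x - (l u + τ v) ∈ openPar (realMat (E b)) → toReal v + y ∈ openPar (realMat (F b)) →
    x - (l u' + τ v') ∈ openPar (realMat (E b')) → toReal v' + y ∈ openPar (realMat (F b')) →
    b = b' ∧ u = u' ∧ v = v'
  cover : ∀ x, ∃ b ∈ 𝓑, ∃ u v, x - (l u + τ v) ∈ Q b ∧ Assoc wh (H b) (toReal v)

namespace IsProductTiling

variable {𝓑 : Set β} {Q : β → Set (ρ → ℝ)} {H : β → Set (σ → ℝ)}
  {E : β → Matrix ρ ρ ℤ} {F : β → Matrix σ σ ℤ} {m : β → ℕ}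
  {l : (ρ → ℤ) → ρ → ℝ} {τ : (σ → ℤ) → ρ → ℝ} {w : ρ → ℝ} {wh : σ → ℝ}

theorem isUnit_det_E (T : IsProductTiling 𝓑 Q H E F m l τ w wh) {b : β} (hb : b ∈ 𝓑) :
    IsUnit (realMat (E b)).det :=
  isUnit_det_realMat (Int.natAbs_ne_zero.1 (by rw [T.natAbs_det_E b hb]; exact T.m_ne_zero b hb))

theorem isUnit_det_F (T : IsProductTiling 𝓑 Q H E F m l τ w wh) {b : β} (hb : b ∈ 𝓑) :
    IsUnit (realMat (F b)).det :=
  isUnit_det_realMat (Int.natAbs_ne_zero.1 (by rw [T.natAbs_det_F b hb]; exact T.m_ne_zero b hb))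

theorem ncard_assoc_H (T : IsProductTiling 𝓑 Q H E F m l τ w wh) {b : β} (hb : b ∈ 𝓑) :
    {v : σ → ℤ | Assoc wh (H b) (toReal v)}.ncard = m b := by
  rw [← T.natAbs_det_F b hb, T.H_eq b hb]
  refine ncard_assoc_fundPar (Int.natAbs_ne_zero.1 ?_) (T.coord_wh b hb)
  rw [T.natAbs_det_F b hb]
  exact T.m_ne_zero b hb

theorem ncard_assoc_Q (T : IsProductTiling 𝓑 Q H E F m l τ w wh) {b : β} (hb : b ∈ 𝓑) :
    {z : ρ → ℤ | Assoc w (Q b) (toReal z)}.ncard = m b := by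
  rw [← T.natAbs_det_E b hb, T.Q_eq b hb]
  refine ncard_assoc_fundPar (Int.natAbs_ne_zero.1 ?_) (T.coord_w b hb)
  rw [T.natAbs_det_E b hb]
  exact T.m_ne_zero b hb

theorem openPieces_disjoint (T : IsProductTiling 𝓑 Q H E F m l τ w wh) {b b' : β} (hb : b ∈ 𝓑)
    (hb' : b' ∈ 𝓑) {v v' : σ → ℤ} (hv : Assoc wh (H b) (toReal v))
    (hv' : Assoc wh (H b') (toReal v')) {x : ρ → ℝ} {u u' : ρ → ℤ}
    (hx : x - (l u + τ v) ∈ openPar (realMat (E b)))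
    (hx' : x - (l u' + τ v') ∈ openPar (realMat (E b'))) : b = b' ∧ u = u' ∧ v = v' := by
  rw [T.H_eq b hb] at hv
  rw [T.H_eq b' hb'] at hv'
  -- At a common small `ε` the height `ε • wh` is interior to both second factors, so an overlap in
  -- the slice is an overlap of open cells of the product.
  obtain ⟨ε, hε, hε'⟩ := ((hv.eventually_mem_openPar (T.isUnit_det_F hb) (T.coord_wh b hb)).and
    (hv'.eventually_mem_openPar (T.isUnit_det_F hb') (T.coord_wh b' hb'))).exists
  exact T.disjoint b hb b' hb' x _ u v u' v' hx hε hx' hε'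

theorem isOpen_openPiece (A : Matrix ρ ρ ℝ) (c : ρ → ℝ) : IsOpen {x | x - c ∈ openPar A} :=
  (isOpen_openPar A).preimage (by fun_prop)

theorem mem_closure_openPiece (T : IsProductTiling 𝓑 Q H E F m l τ w wh) {b : β} (hb : b ∈ 𝓑)
    {x c : ρ → ℝ} (h : x - c ∈ Q b) : x ∈ closure {x | x - c ∈ openPar (realMat (E b))} := by
  rw [T.Q_eq b hb] at h
  have := fundPar_subset_closure_openPar (T.isUnit_det_E hb) h
  have heq := (Homeomorph.subRight c).preimage_closure (openPar (realMat (E b)))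
  exact heq.subset this

theorem pieces_meetAtBoundary (T : IsProductTiling 𝓑 Q H E F m l τ w wh) {b b' : β} (hb : b ∈ 𝓑)
    (hb' : b' ∈ 𝓑) {v v' : σ → ℤ} (hv : Assoc wh (H b) (toReal v))
    (hv' : Assoc wh (H b') (toReal v')) (hne : (b, v) ≠ (b', v')) :
    MeetAtBoundary (translate (Q b) (τ v)) (translate (Q b') (τ v')) := by
  refine meetAtBoundary_of_disjoint
    (𝒪 := {{x | x - (l 0 + τ v) ∈ openPar (realMat (E b))}})
    (𝒩 := {{x | x - (l 0 + τ v') ∈ openPar (realMat (E b'))}}) ?_ ?_ ?_ ?_ ?_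
  · rintro _ rfl; exact isOpen_openPiece _ _
  · rintro _ rfl; exact isOpen_openPiece _ _
  · intro x hx
    refine ⟨_, rfl, T.mem_closure_openPiece hb ?_⟩
    rw [T.l_zero, zero_add]
    exact mem_translate.1 hx
  · intro x hx
    refine ⟨_, rfl, T.mem_closure_openPiece hb' ?_⟩
    rw [T.l_zero, zero_add]
    exact mem_translate.1 hx
  · rintro _ rfl _ rfl x hx hx'
    obtain ⟨h₁, -, h₂⟩ := T.openPieces_disjoint hb hb' hv hv' hx hx'
    exact hne (by rw [h₁, h₂])

theorem iUnion_translate_eq_univ (T : IsProductTiling 𝓑 Q H E F m l τ w wh) :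
    (⋃ u, translate (⋃ b ∈ 𝓑, ⋃ v ∈ {v : σ → ℤ | Assoc wh (H b) (toReal v)},
      translate (Q b) (τ v)) (l u)) = univ := by
  refine eq_univ_of_forall fun x => ?_
  obtain ⟨b, hb, u, v, hx, hv⟩ := T.cover x
  refine mem_iUnion.2 ⟨u, mem_translate.2 (mem_iUnion₂.2 ⟨b, hb, mem_iUnion₂.2 ⟨v, hv, ?_⟩⟩)⟩
  rwa [mem_translate, sub_sub]

theorem tiles_meetAtBoundary (T : IsProductTiling 𝓑 Q H E F m l τ w wh) {u u' : ρ → ℤ}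
    (hne : u ≠ u') :
    MeetAtBoundary
      (translate (⋃ b ∈ 𝓑, ⋃ v ∈ {v : σ → ℤ | Assoc wh (H b) (toReal v)},
        translate (Q b) (τ v)) (l u))
      (translate (⋃ b ∈ 𝓑, ⋃ v ∈ {v : σ → ℤ | Assoc wh (H b) (toReal v)},
        translate (Q b) (τ v)) (l u')) := by
  let 𝒪 : (ρ → ℤ) → Set (Set (ρ → ℝ)) := fun u => {O | ∃ b ∈ 𝓑, ∃ v : σ → ℤ,
    Assoc wh (H b) (toReal v) ∧ O = {x | x - (l u + τ v) ∈ openPar (realMat (E b))}}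
  have hopen : ∀ u, ∀ O ∈ 𝒪 u, IsOpen O := by
    rintro u _ ⟨b, -, v, -, rfl⟩
    exact isOpen_openPiece _ _
  have hcl : ∀ u, ∀ x ∈ translate (⋃ b ∈ 𝓑, ⋃ v ∈ {v : σ → ℤ | Assoc wh (H b) (toReal v)},
      translate (Q b) (τ v)) (l u), ∃ O ∈ 𝒪 u, x ∈ closure O := by
    intro u x hx
    obtain ⟨b, hb, hx⟩ := mem_iUnion₂.1 (mem_translate.1 hx)
    obtain ⟨v, hv, hx⟩ := mem_iUnion₂.1 hx
    refine ⟨_, ⟨b, hb, v, hv, rfl⟩, T.mem_closure_openPiece hb ?_⟩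
    rwa [mem_translate, sub_sub] at hx
  refine meetAtBoundary_of_disjoint (hopen u) (hopen u') (hcl u) (hcl u') ?_
  rintro _ ⟨b, hb, v, hv, rfl⟩ _ ⟨b', hb', v', hv', rfl⟩ x hx hx'
  exact hne (T.openPieces_disjoint hb hb' hv hv' hx hx').2.1

/-- The points are the sums `z + n v` with `z` associated with `Q b` and `v` with `H b`, giving `m
b` choices for each. Membership in the tile follows from association because `Q b` is closed. -/
theorem ncard_integer_points (T : IsProductTiling 𝓑 Q H E F m l τ w wh) {b : β} (hb : b ∈ 𝓑) :
    {z : ρ → ℤ | toReal z ∈ (⋃ b ∈ 𝓑, ⋃ v ∈ {v : σ → ℤ | Assoc wh (H b) (toReal v)},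
        translate (Q b) (τ v)) ∧
      Assoc w (⋃ v ∈ {v : σ → ℤ | Assoc wh (H b) (toReal v)}, translate (Q b) (τ v))
        (toReal z)}.ncard = m b ^ 2 := by
  choose n hn using T.τ_int
  have hclosed : IsClosed (Q b) := T.Q_eq b hb ▸ (isCompact_fundPar _).isClosed
  have hconvex : Convex ℝ (Q b) := T.Q_eq b hb ▸ convex_fundPar _
  have hfin : {v : σ → ℤ | Assoc wh (H b) (toReal v)}.Finite :=
    finite_of_ncard_ne_zero (by rw [T.ncard_assoc_H hb]; exact T.m_ne_zero b hb)
  have himage : {z : ρ → ℤ | toReal z ∈ (⋃ b ∈ 𝓑, ⋃ v ∈ {v : σ → ℤ | Assoc wh (H b) (toReal v)},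
        translate (Q b) (τ v)) ∧
      Assoc w (⋃ v ∈ {v : σ → ℤ | Assoc wh (H b) (toReal v)}, translate (Q b) (τ v)) (toReal z)}
      = (fun p : (σ → ℤ) × (ρ → ℤ) => p.2 + n p.1) ''
        ({v : σ → ℤ | Assoc wh (H b) (toReal v)} ×ˢ
          {z : ρ → ℤ | Assoc w (Q b) (toReal z)}) := by
    ext z
    constructor
    · rintro ⟨-, hz⟩
      have hex : ∃ᶠ ε : ℝ in 𝓝[>] 0, ∃ v ∈ {v : σ → ℤ | Assoc wh (H b) (toReal v)},
          toReal z + ε • w ∈ translate (Q b) (τ v) :=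
        (hz.mono fun ε hε => by simpa only [mem_iUnion₂, exists_prop] using hε).frequently
      -- The translate containing `z + ε w` could vary with `ε`; finiteness selects one that recurs
      -- as `ε → 0`.
      obtain ⟨v, hv, hfreq⟩ := (frequently_exists_finite hfin).1 hex
      refine ⟨(v, z - n v), ⟨hv, assoc_of_frequently hclosed hconvex (hfreq.mono fun ε hε => ?_)⟩,
        sub_add_cancel _ _⟩
      rwa [mem_translate, hn, add_sub_right_comm, ← toReal_sub] at hε
    · rintro ⟨⟨v, z⟩, ⟨hv, hz⟩, rfl⟩
      refine ⟨mem_iUnion₂.2 ⟨b, hb, mem_iUnion₂.2 ⟨v, hv, ?_⟩⟩,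
        Eventually.mono (show ∀ᶠ ε : ℝ in 𝓝[>] 0, toReal z + ε • w ∈ Q b from hz) fun ε hε =>
          mem_iUnion₂.2 ⟨v, hv, ?_⟩⟩
      · rw [mem_translate, hn, toReal_add, add_sub_cancel_right]
        exact Assoc.mem hclosed hz
      · rw [mem_translate, hn, toReal_add, add_right_comm, add_sub_cancel_right]
        exact hε
  have hinj : InjOn (fun p : (σ → ℤ) × (ρ → ℤ) => p.2 + n p.1)
      ({v : σ → ℤ | Assoc wh (H b) (toReal v)} ×ˢ {z : ρ → ℤ | Assoc w (Q b) (toReal z)}) := by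
    rintro ⟨v, z⟩ ⟨hv, hz⟩ ⟨v', z'⟩ ⟨hv', hz'⟩ heq
    simp only [mem_ofPred_eq, T.Q_eq b hb] at hz hz'
    obtain ⟨ε, hε, hε'⟩ := ((hz.eventually_mem_openPar (T.isUnit_det_E hb) (T.coord_w b hb)).and
      (hz'.eventually_mem_openPar (T.isUnit_det_E hb) (T.coord_w b hb))).exists
    have heq' : toReal z + toReal (n v) = toReal z' + toReal (n v') := by
      rw [← toReal_add, ← toReal_add]
      exact congrArg toReal heq
    -- Equal sums, moved by a small `ε • w`, give a point in the interiors of both translates, so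
    -- the shifts `v` and `v'` agree.
    have hvv := (T.openPieces_disjoint hb hb hv hv' (u := 0) (u' := 0)
      (x := toReal z + toReal (n v) + ε • w)
      (by rw [T.l_zero, hn]; convert hε using 1; abel)
      (by rw [heq', T.l_zero, hn]; convert hε' using 1; abel)).2.2
    subst hvv
    simpa using heq
  rw [himage, hinj.ncard_image, ncard_prod, T.ncard_assoc_H hb, T.ncard_assoc_Q hb, sq]

end IsProductTiling

end ProductTiling

section Factors

variable {r s : ℕ}

/-! ### The tilings in the two factors -/

open Classical in
/-- An ordering of the columns that lists the basis `B` first. -/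
def frameOf (M : Matrix (Fin r) (Fin s) ℤ) (B : Finset (Fin r ⊕ Fin s)) :
    Fin r ⊕ Fin s ≃ Fin r ⊕ Fin s :=
  if h : ∃ e, IsFrame M B e then h.choose else Equiv.refl _

theorem isFrame_frameOf {M : Matrix (Fin r) (Fin s) ℤ} {B : Finset (Fin r ⊕ Fin s)}
    (hB : IsBasis M B) : IsFrame M B (frameOf M B) := by
  have h := exists_isFrame M hB.1
  rw [frameOf, dif_pos h]
  exact h.choose_spec

theorem mult_ne_zero {M : Matrix (Fin r) (Fin s) ℤ} {B : Finset (Fin r ⊕ Fin s)}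
    (hB : IsBasis M B) : mult M B ≠ 0 := Int.natAbs_ne_zero.2 hB.2

theorem IsFrame.det₁_ne_zero {M : Matrix (Fin r) (Fin s) ℤ} {B : Finset (Fin r ⊕ Fin s)}
    {e : Fin r ⊕ Fin s ≃ Fin r ⊕ Fin s} (he : IsFrame M B e) (hB : IsBasis M B) :
    (frame₁ M e).det ≠ 0 :=
  Int.natAbs_ne_zero.1 (he.natAbs_det₁ ▸ mult_ne_zero hB)

theorem IsFrame.det₂_ne_zero {M : Matrix (Fin r) (Fin s) ℤ} {B : Finset (Fin r ⊕ Fin s)}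
    {e : Fin r ⊕ Fin s ≃ Fin r ⊕ Fin s} (he : IsFrame M B e) (hB : IsBasis M B) :
    (frame₂ M e).det ≠ 0 :=
  Int.natAbs_ne_zero.1 (he.natAbs_det₂ ▸ mult_ne_zero hB)

theorem IsShiftingVector.frame_coord_ne_zero {M : Matrix (Fin r) (Fin s) ℤ}
    {w : Fin r → ℝ} {wh : Fin s → ℝ} (hw : IsShiftingVector M (Sum.elim w wh))
    {B : Finset (Fin r ⊕ Fin s)} (hB : IsBasis M B)
    {e : Fin r ⊕ Fin s ≃ Fin r ⊕ Fin s} (he : IsFrame M B e) :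
    (∀ j, ((realMat (frame₁ M e))⁻¹ *ᵥ w) j ≠ 0) ∧
      ∀ j, ((realMat (frame₂ M e))⁻¹ *ᵥ wh) j ≠ 0 := by
  set a := Sum.elim ((realMat (frame₁ M e))⁻¹ *ᵥ w) ((realMat (frame₂ M e))⁻¹ *ᵥ wh) ∘ e.symm
    with ha
  have h₁ : a ∘ e ∘ Sum.inl = (realMat (frame₁ M e))⁻¹ *ᵥ w := by ext; simp [ha]
  have h₂ : a ∘ e ∘ Sum.inr = (realMat (frame₂ M e))⁻¹ *ᵥ wh := by ext; simp [ha]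
  have hmul : prodMatrix M B *ᵥ a = Sum.elim w wh := by
    rw [he.prodMatrix_mulVec, h₁, h₂, mulVec_inv_mulVec (isUnit_det_realMat (he.det₁_ne_zero hB)),
      mulVec_inv_mulVec (isUnit_det_realMat (he.det₂_ne_zero hB))]
  have hne := hw.coord_ne_zero hB hmul
  exact ⟨fun j => congrFun h₁ j ▸ hne (e (Sum.inl j)), fun j => congrFun h₂ j ▸ hne (e (Sum.inr j))⟩

theorem basisCells_disjoint {M : Matrix (Fin r) (Fin s) ℤ} {B B' : Finset (Fin r ⊕ Fin s)}
    (hB : IsBasis M B) (hB' : IsBasis M B')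
    {Z Z' : Fin r ⊕ Fin s → ℤ} {x : Fin r → ℝ} {y : Fin s → ℝ}
    (hx : x - toReal (stdMatrix M *ᵥ Z) ∈ openPar (realMat (frame₁ M (frameOf M B))))
    (hy : y + toReal (dualMatrix M *ᵥ Z) ∈ openPar (realMat (frame₂ M (frameOf M B))))
    (hx' : x - toReal (stdMatrix M *ᵥ Z') ∈ openPar (realMat (frame₁ M (frameOf M B'))))
    (hy' : y + toReal (dualMatrix M *ᵥ Z') ∈ openPar (realMat (frame₂ M (frameOf M B')))) :
    B = B' ∧ Z = Z' := by
  have he := isFrame_frameOf hB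
  have he' := isFrame_frameOf hB'
  obtain ⟨h₁, h₂⟩ := openCells_disjoint (he.det₁_ne_zero hB) (he.det₂_ne_zero hB)
    (he'.det₁_ne_zero hB') (he'.det₂_ne_zero hB') hx hy hx' hy'
  refine ⟨Finset.ext fun j => ?_, h₂⟩
  rw [← he.isLeft_iff, ← he'.isLeft_iff, h₁]

theorem stdMatrix_mulVec (M : Matrix (Fin r) (Fin s) ℤ) (Z : Fin r ⊕ Fin s → ℤ) :
    stdMatrix M *ᵥ Z = Z ∘ Sum.inl + M *ᵥ (Z ∘ Sum.inr) := by
  rw [stdMatrix, Matrix.fromCols_mulVec, Matrix.one_mulVec]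

theorem dualMatrix_mulVec (M : Matrix (Fin r) (Fin s) ℤ) (Z : Fin r ⊕ Fin s → ℤ) :
    dualMatrix M *ᵥ Z = -(Mᵀ *ᵥ (Z ∘ Sum.inl)) + Z ∘ Sum.inr := by
  rw [dualMatrix, Matrix.fromCols_mulVec, Matrix.one_mulVec, Matrix.neg_mulVec]

theorem stdMatrix_mul_transpose_mulVec (M : Matrix (Fin r) (Fin s) ℤ) (u : Fin r → ℤ) :
    (stdMatrix M * (stdMatrix M)ᵀ) *ᵥ u = u + M *ᵥ (Mᵀ *ᵥ u) := by
  rw [stdMatrix, Matrix.transpose_fromCols, Matrix.fromCols_mul_fromRows, Matrix.add_mulVec,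
    Matrix.mulVec_mulVec]
  simp

theorem dualMatrix_mul_transpose_mulVec (M : Matrix (Fin r) (Fin s) ℤ) (u : Fin s → ℤ) :
    (dualMatrix M * (dualMatrix M)ᵀ) *ᵥ u = Mᵀ *ᵥ (M *ᵥ u) + u := by
  rw [dualMatrix, Matrix.transpose_fromCols, Matrix.fromCols_mul_fromRows, Matrix.add_mulVec,
    Matrix.mulVec_mulVec]
  simp

/-- The substitution `Z = (u, Mᵀ u + v)` is a bijective change of lattice coordinates with `D̂ Z =
v` and `D Z = D Dᵀ u + M v`. -/
theorem isProductTiling₁ {M : Matrix (Fin r) (Fin s) ℤ}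
    {w : Fin r → ℝ} {wh : Fin s → ℝ} (hw : IsShiftingVector M (Sum.elim w wh)) :
    IsProductTiling {B | IsBasis M B} (P₁ M) (P₂ M) (fun B => frame₁ M (frameOf M B))
      (fun B => frame₂ M (frameOf M B)) (mult M)
      (fun u => toReal ((stdMatrix M * (stdMatrix M)ᵀ) *ᵥ u)) (fun v => toReal (M *ᵥ v)) w wh where
  Q_eq _ hB := (isFrame_frameOf hB).P₁_eq
  H_eq _ hB := (isFrame_frameOf hB).P₂_eq
  natAbs_det_E _ hB := (isFrame_frameOf hB).natAbs_det₁
  natAbs_det_F _ hB := (isFrame_frameOf hB).natAbs_det₂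
  m_ne_zero _ hB := mult_ne_zero hB
  coord_w _ hB := (hw.frame_coord_ne_zero hB (isFrame_frameOf hB)).1
  coord_wh _ hB := (hw.frame_coord_ne_zero hB (isFrame_frameOf hB)).2
  l_zero := by ext; simp [toReal]
  τ_int v := ⟨_, rfl⟩
  disjoint B hB B' hB' x y u v u' v' hx hy hx' hy' := by
    have h₁ : ∀ u v, stdMatrix M *ᵥ Sum.elim u (Mᵀ *ᵥ u + v)
        = (stdMatrix M * (stdMatrix M)ᵀ) *ᵥ u + M *ᵥ v := by
      intro u v
      rw [stdMatrix_mulVec, stdMatrix_mul_transpose_mulVec, Sum.elim_comp_inl, Sum.elim_comp_inr,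
        Matrix.mulVec_add, add_assoc]
    have h₂ : ∀ u v, dualMatrix M *ᵥ Sum.elim u (Mᵀ *ᵥ u + v) = v := by
      intro u v
      rw [dualMatrix_mulVec, Sum.elim_comp_inl, Sum.elim_comp_inr, neg_add_cancel_left]
    rw [← toReal_add, ← h₁] at hx hx'
    rw [add_comm, ← h₂ u v] at hy
    rw [add_comm, ← h₂ u' v'] at hy'
    obtain ⟨hBB, hZ⟩ := basisCells_disjoint hB hB' hx hy hx' hy'
    have hu : u = u' := by simpa using congrArg (· ∘ Sum.inl) hZ
    have hv := congrArg (dualMatrix M *ᵥ ·) hZ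
    simp only [h₂] at hv
    exact ⟨hBB, hu, hv⟩
  cover x := by
    -- Starting at height `0` and moving only in the second factor keeps `x` in the first factor of
    -- the cell while making `D̂ Z` associated with the second.
    obtain ⟨B, Z, hB, hZ⟩ := exists_assoc_cell M (Sum.elim x 0) (Sum.elim 0 wh)
    have hD : stdMatrix M *ᵥ Z = (stdMatrix M * (stdMatrix M)ᵀ) *ᵥ (Z ∘ Sum.inl)
        + M *ᵥ (dualMatrix M *ᵥ Z) := by
      rw [stdMatrix_mulVec, stdMatrix_mul_transpose_mulVec, dualMatrix_mulVec, add_assoc,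
        ← Matrix.mulVec_add, add_neg_cancel_left]
    refine ⟨B, hB, Z ∘ Sum.inl, dualMatrix M *ᵥ Z, ?_, ?_⟩
    · obtain ⟨ε, hε⟩ := hZ.exists
      rw [← toReal_add, ← hD]
      convert hε.1 using 1
      ext i
      simp [latt]
    · refine Eventually.mono hZ fun ε hε => ?_
      convert hε.2 using 1
      ext i
      simp [latt]

/-- With the factors exchanged, the substitution is `Z = (M u - v, -u)`, for which `D Z = -v` and
`-D̂ Z = D̂ D̂ᵀ u - Mᵀ v`. -/
theorem isProductTiling₂ {M : Matrix (Fin r) (Fin s) ℤ}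
    {w : Fin r → ℝ} {wh : Fin s → ℝ} (hw : IsShiftingVector M (Sum.elim w wh)) :
    IsProductTiling {B | IsBasis M B} (P₂ M) (P₁ M) (fun B => frame₂ M (frameOf M B))
      (fun B => frame₁ M (frameOf M B)) (mult M)
      (fun u => toReal ((dualMatrix M * (dualMatrix M)ᵀ) *ᵥ u)) (fun v => -toReal (Mᵀ *ᵥ v))
      wh w where
  Q_eq _ hB := (isFrame_frameOf hB).P₂_eq
  H_eq _ hB := (isFrame_frameOf hB).P₁_eq
  natAbs_det_E _ hB := (isFrame_frameOf hB).natAbs_det₂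
  natAbs_det_F _ hB := (isFrame_frameOf hB).natAbs_det₁
  m_ne_zero _ hB := mult_ne_zero hB
  coord_w _ hB := (hw.frame_coord_ne_zero hB (isFrame_frameOf hB)).2
  coord_wh _ hB := (hw.frame_coord_ne_zero hB (isFrame_frameOf hB)).1
  l_zero := by ext; simp [toReal]
  τ_int v := ⟨_, (toReal_neg _).symm⟩
  disjoint B hB B' hB' y x u v u' v' hy hx hy' hx' := by
    have h₁ : ∀ u v, stdMatrix M *ᵥ Sum.elim (M *ᵥ u - v) (-u) = -v := by
      intro u v
      rw [stdMatrix_mulVec, Sum.elim_comp_inl, Sum.elim_comp_inr, Matrix.mulVec_neg]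
      abel
    have h₂ : ∀ u v, dualMatrix M *ᵥ Sum.elim (M *ᵥ u - v) (-u)
        = -((dualMatrix M * (dualMatrix M)ᵀ) *ᵥ u + -(Mᵀ *ᵥ v)) := by
      intro u v
      rw [dualMatrix_mulVec, dualMatrix_mul_transpose_mulVec, Sum.elim_comp_inl,
        Sum.elim_comp_inr, Matrix.mulVec_sub]
      abel
    have h₁' : ∀ u v, toReal v + x = x - toReal (stdMatrix M *ᵥ Sum.elim (M *ᵥ u - v) (-u)) := by
      intro u v
      rw [h₁, toReal_neg]
      abel
    have h₂' : ∀ u v, y - (toReal ((dualMatrix M * (dualMatrix M)ᵀ) *ᵥ u) + -toReal (Mᵀ *ᵥ v))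
        = y + toReal (dualMatrix M *ᵥ Sum.elim (M *ᵥ u - v) (-u)) := by
      intro u v
      rw [h₂, toReal_neg, toReal_add, toReal_neg, sub_eq_add_neg]
    rw [h₁' u v] at hx
    rw [h₁' u' v'] at hx'
    rw [h₂' u v] at hy
    rw [h₂' u' v'] at hy'
    obtain ⟨hBB, hZ⟩ := basisCells_disjoint hB hB' hx hy hx' hy'
    have hu : u = u' := by simpa using congrArg (· ∘ Sum.inr) hZ
    have hv := congrArg (stdMatrix M *ᵥ ·) hZ
    simp only [h₁, neg_inj] at hv
    exact ⟨hBB, hu, hv⟩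
  cover y := by
    obtain ⟨B, Z, hB, hZ⟩ := exists_assoc_cell M (Sum.elim 0 y) (Sum.elim w 0)
    have hD : -(dualMatrix M *ᵥ Z) = (dualMatrix M * (dualMatrix M)ᵀ) *ᵥ (-(Z ∘ Sum.inr))
        + -(Mᵀ *ᵥ (-(stdMatrix M *ᵥ Z))) := by
      rw [stdMatrix_mulVec, dualMatrix_mul_transpose_mulVec, dualMatrix_mulVec,
        Matrix.mulVec_neg, Matrix.mulVec_neg, Matrix.mulVec_neg, Matrix.mulVec_add]
      abel
    refine ⟨B, hB, -(Z ∘ Sum.inr), -(stdMatrix M *ᵥ Z), ?_, ?_⟩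
    · obtain ⟨ε, hε⟩ := hZ.exists
      rw [← toReal_neg, ← toReal_add, ← hD]
      convert hε.2 using 1
      ext i
      simp [latt, toReal_neg]
    · refine Eventually.mono hZ fun ε hε => ?_
      convert hε.1 using 1
      ext i
      simp [latt, toReal_neg]

end Factors

end StdRep

end

/-! ### The main theorem, from the two slices -/

theorem mainTheorem7 {r s : ℕ} (M : Matrix (Fin r) (Fin s) ℤ)
    (w : Fin r → ℝ) (wh : Fin s → ℝ) (hw : StdRep.IsShiftingVector M (Sum.elim w wh)) :
    -- each basis contributes `m(B)` translates to either tile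
    (∀ B, StdRep.IsBasis M B →
      (StdRep.shifts₁ M wh B).ncard = StdRep.mult M B ∧
      (StdRep.shifts₂ M w B).ncard = StdRep.mult M B) ∧
    -- the parallelepipeds of `T'(D)` meet only at their boundaries
    (∀ B B', StdRep.IsBasis M B → StdRep.IsBasis M B' →
      ∀ z ∈ StdRep.shifts₁ M wh B, ∀ z' ∈ StdRep.shifts₁ M wh B', (B, z) ≠ (B', z') →
        StdRep.MeetAtBoundary (StdRep.piece₁ M B z) (StdRep.piece₁ M B' z')) ∧
    -- the parallelepipeds of `T''(D)` meet only at their boundaries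
    (∀ B B', StdRep.IsBasis M B → StdRep.IsBasis M B' →
      ∀ z ∈ StdRep.shifts₂ M w B, ∀ z' ∈ StdRep.shifts₂ M w B', (B, z) ≠ (B', z') →
        StdRep.MeetAtBoundary (StdRep.piece₂ M B z) (StdRep.piece₂ M B' z')) ∧
    -- the translates of `T'(D)` by `D Dᵀ ℤʳ` tile `ℝʳ`
    ((⋃ z : Fin r → ℤ, StdRep.tileTranslate₁ M wh z) = Set.univ ∧
      ∀ z z' : Fin r → ℤ, z ≠ z' →
        StdRep.MeetAtBoundary (StdRep.tileTranslate₁ M wh z) (StdRep.tileTranslate₁ M wh z')) ∧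
    -- the translates of `T''(D)` by `D̂ D̂ᵀ ℤⁿ⁻ʳ` tile `ℝⁿ⁻ʳ`
    ((⋃ z : Fin s → ℤ, StdRep.tileTranslate₂ M w z) = Set.univ ∧
      ∀ z z' : Fin s → ℤ, z ≠ z' →
        StdRep.MeetAtBoundary (StdRep.tileTranslate₂ M w z) (StdRep.tileTranslate₂ M w z')) ∧
    -- `m(B)²` integer points of `T'(D)` are shifted by `w` into the translates of `P₁(B)`
    (∀ B, StdRep.IsBasis M B →
      {z : Fin r → ℤ | StdRep.toReal z ∈ StdRep.tile₁ M wh ∧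
        StdRep.Assoc w (⋃ y ∈ StdRep.shifts₁ M wh B, StdRep.piece₁ M B y)
          (StdRep.toReal z)}.ncard = StdRep.mult M B ^ 2) ∧
    -- `m(B)²` integer points of `T''(D)` are shifted by `ŵ` into the translates of `P₂(B)`
    (∀ B, StdRep.IsBasis M B →
      {z : Fin s → ℤ | StdRep.toReal z ∈ StdRep.tile₂ M w ∧
        StdRep.Assoc wh (⋃ y ∈ StdRep.shifts₂ M w B, StdRep.piece₂ M B y)
          (StdRep.toReal z)}.ncard = StdRep.mult M B ^ 2) := by
  have T₁ := StdRep.isProductTiling₁ hw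
  have T₂ := StdRep.isProductTiling₂ hw
  exact ⟨fun B hB => ⟨T₁.ncard_assoc_H hB, T₂.ncard_assoc_H hB⟩,
    fun B B' hB hB' z hz z' hz' hne => T₁.pieces_meetAtBoundary hB hB' hz hz' hne,
    fun B B' hB hB' z hz z' hz' hne => T₂.pieces_meetAtBoundary hB hB' hz hz' hne,
    ⟨T₁.iUnion_translate_eq_univ, fun z z' hne => T₁.tiles_meetAtBoundary hne⟩,
    ⟨T₂.iUnion_translate_eq_univ, fun z z' hne => T₂.tiles_meetAtBoundary hne⟩,
    fun B hB => T₁.ncard_integer_points hB, fun B hB => T₂.ncard_integer_points hB⟩
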